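/- **Soundness of the refinement logic (trace inclusion).** *States.* Fix sets of variables, addresses and values (the values contain the addresses, the Booleans and all finite sequences of values), a set of ghost addresses, and finitely many programmer locks together with two further ghost locks $\mathcal G$ and $\mathcal I$. A stack maps variables to values; an expression is a function from stacks to values. A heap is a finite partial map from addresses to pairs (permission in $(0,1]$, value); $\mathfrak h_1\oplus\mathfrak h_2$ adds permissions pointwise and is defined iff values agree on common addresses and the sums are at most $1$. A heap is normal if all its permissions are $1$. $\mathrm{FV}(\cdot)$ denotes the variables on which an expression, assertion or lock invariant depends; $\mathrm{FV}(C)$ those occurring in a command and $\mathrm{Mod}(C)$ those assigned by it. *Abstract model.* Fix an abstract transition system $\mathrm{ATS}$ with $k\ge 1$ variables $x_1,\dots,x_k$ ($x_1$ observable), an initial-state predicate $\mathrm{Init}(\vec x)$ and a next-state predicate $\mathrm{Next}(\vec x,\vec x')$ with $\mathrm{Next}(\vec v,\vec v)$ for all $\vec v$. Its paths are the finite non-empty sequences $\sigma_1\dots\sigma_n$ with $\mathrm{Init}(\sigma_1)$ and $\mathrm{Next}(\sigma_i,\sigma_{i+1})$; $\mathrm{Traces}(\mathrm{ATS})$ consists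 of the empty trace and of the projections of all paths to $x_1$. Each $x_i$ is stored at a ghost address $\ell_i$, the $\ell_i$ being distinct; $\mathtt{stdOut}=\ell_1$. *Commands* are $\mathtt{skip}$, $x:=E$, $[E]:=E'$, $x:=[E]$, $\mathtt{free}(E)$, $x:=\mathtt{new}(E)$, $\mathtt{print}(E)$, $C;C$, conditionals, $\mathtt{while}$, $C\parallel C$, $\mathtt{lock}\ L\ \{C\}$ (declares $L$), $\mathtt{with}\ L\ \mathtt{when}\ E\ \{C\}$, the internal $\mathtt{within}\ L\ \{C\}$ ($L$ is held), $\mathtt{Init}\{C\}$ and $\mathtt{Next}\{C\}$. Configurations are triples (command, stack, normal heap) or $\mathtt{abort}$. The small-step relation $\to$ is that of concurrent separation logic (interleaving; $C_1\parallel C_2$ never hold the same lock; $\mathtt{abort}$ on access to an unallocated address, on a data race, or when a held lock is acquired again), extended by: $\mathtt{print}(E)$ appends the value of $E$ to the sequence stored at $\mathtt{stdOut}$ and aborts if $\mathtt{stdOut}$ is unallocated; $\mathtt{Init}\{C\}$ steps to $\mathtt{lock}\ \mathcal G\ \{C\}$; and if $C$ is atomic and $(C,s,h)\to^*(\mathtt{skip},s',h')$,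 then $(\mathtt{Next}\{C\},s,h)\to(\mathtt{skip},s',h')$. Which commands are atomic is an arbitrary parameter, except that an atomic command contains no critical region ($\mathtt{with}$ or $\mathtt{within}$). *Logic.* A lock environment $\Gamma$ is a finite partial map from locks to assertions; $\Gamma(L)$ is $\mathtt{emp}$ if undefined, and $\Gamma,L:R$ is formed only if $L\notin\mathrm{dom}\,\Gamma$. $\Gamma\vdash_{\mathcal R}\{P\}\,C\,\{Q\}$ is derived with the standard rules of concurrent separation logic with fractional permissions for $\mathtt{skip}$, assignment, read, write, allocation, deallocation (of non-ghost addresses only), sequence, conditionals, loops, parallel composition (for $\{i,j\}=\{1,2\}$: $\mathrm{FV}(P_i,C_i,Q_i,\Gamma)\cap\mathrm{Mod}(C_j)=\emptyset$), lock declaration and critical regions (programmer locks only), frame, consequence, existentials ($\{\exists x.P\}C\{\exists x.Q\}$ from $\{P\}C\{Q\}$ if $x\notin\mathrm{FV}(C,\Gamma)$), conjunction (if all $\Gamma(L)$ are precise) and disjunction, and with three further rules. There $A(\vec y)$ says that each $\ell_i$ stores $y_i$ and is separately owned with permission at least $\rho$, for some $\rho>0$ such that $G$ entails separate ownership of every $\ell_i$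 with permission at least $\rho$; and $\vec o$ are distinct variables not free in $P,Q,G,\Gamma,C$. * Init: from $\Gamma,\mathcal G:G,\mathcal I:\mathtt{emp}\vdash_{\mathcal R}\{P\}C\{Q\}$ infer $\Gamma\vdash_{\mathcal R}\{(\exists\vec y.\,A(\vec y)\wedge\mathrm{Init}(\vec y)\wedge G)*P\}\ \mathtt{Init}\{C\}\ \{G*Q\}$. * Next: if $C$ is atomic, from $\Gamma\vdash_{\mathcal R}\{(A(\vec o)\wedge G)*P\}\ C\ \{(\exists\vec y.\,A(\vec y)\wedge\mathrm{Next}(\vec o,\vec y)\wedge G)*Q\}$ infer $\Gamma,\mathcal G:G\vdash_{\mathcal R}\{P\}\ \mathtt{Next}\{C\}\ \{Q\}$. * Print: $\Gamma,\mathcal I:\mathtt{emp}\vdash_{\mathcal R}\{\mathtt{stdOut}\stackrel{1}{\mapsto}E'\}\ \mathtt{print}(E)\ \{\mathtt{stdOut}\stackrel{1}{\mapsto}E'\mathbin{+\!\!+}[E]\}$. *Traces.* A configuration $(C,s,h)$ is observed as the one-element sequence $[h(\mathtt{stdOut})]$ if $\mathcal G$ is declared in $C$; all other configurations are observed as the empty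 sequence. For a set $I$ of configurations, $\mathrm{Traces}(I)$ is the set of concatenated observations along all finite executions $c_1\to\dots\to c_n$ with $c_1\in I$. Let $I(C,P,\Gamma)$ be the set of all $(C,s,\mathfrak h\oplus\mathfrak h_S\oplus\mathfrak h_F)$ such that the sum is defined and normal, $s,\mathfrak h\models P$, and $\mathfrak h_S$ satisfies at $s$ the separating conjunction of $\Gamma(L)$ over all locks $L$ not held by $C$. **Theorem.** Let $C=(C_1;\mathtt{Init}\{C_2\})$, where $C_1$ contains no $\mathtt{Init}$ block. If $\Gamma\vdash_{\mathcal R}\{P\}\,C\,\{Q\}$, then $\mathrm{Traces}(I(C,P,\Gamma))\subseteq\mathrm{Traces}(\mathrm{ATS})$. In particular $\mathtt{stdOut}$ is allocated in every observed configuration. -/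

import Mathlib

namespace CSLRef

/-! ### Values, stacks, heaps with fractional permissions -/

/-- The set `V` of values contains the addresses, the Booleans and the sequences of values. -/
structure ValueModel (Addr V : Type*) where
  addr : Addr ↪ V
  bool : Bool ↪ V
  seq : List V ↪ V

open Classical in
/-- `M.append e v` puts the value `e` at the end of the sequence `v`
(values that are not sequences are left unchanged). -/
noncomputable def ValueModel.append {Addr V : Type*} (M : ValueModel Addr V) (e v : V) : V :=
  if h : ∃ l : List V, M.seq l = v then M.seq (h.choose ++ [e]) else v

theorem ValueModel.append_seq {Addr V : Type*} (M : ValueModel Addr V) (e : V) (l : List V) :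
    M.append e (M.seq l) = M.seq (l ++ [e]) := by
  have h : ∃ l' : List V, M.seq l' = M.seq l := ⟨l, rfl⟩
  have h2 : h.choose = l := M.seq.injective h.choose_spec
  unfold ValueModel.append
  rw [dif_pos h, h2]

/-- A stack is a valuation of the variables. -/
abbrev Stack (Var V : Type*) := Var → V

open Classical in
/-- The stack `s[x := v]`. -/
noncomputable def Stack.set {Var V : Type*} (s : Stack Var V) (x : Var) (v : V) : Stack Var V :=
  fun y => if y = x then v else s y

/-- Expressions are identified with their evaluation functions. -/
abbrev Expr (Var V : Type*) := Stack Var V → V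

/-- Fractional permissions in `(0, 1]`; `1` is write access, anything smaller is read access,
and an address without any permission is not in the domain of the heap. -/
abbrev Perm : Type := {r : ℝ // 0 < r ∧ r ≤ 1}

/-- The full permission `1`. -/
def Perm.full : Perm := ⟨1, one_pos, le_refl 1⟩

/-- Heaps: finite partial functions from addresses to permission-value pairs. -/
@[ext]
structure Heap (Addr V : Type*) where
  cell : Addr → Option (Perm × V)
  finite_dom : {a | cell a ≠ none}.Finite

/-- The domain of a heap. -/
def Heap.dom {Addr V : Type*} (h : Heap Addr V) : Set Addr := {a | h.cell a ≠ none}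

/-- The empty heap. -/
def Heap.empty {Addr V : Type*} : Heap Addr V where
  cell := fun _ => none
  finite_dom := by simp

open Classical in
/-- The heap `h[a := (p, v)]`. -/
noncomputable def Heap.set {Addr V : Type*} (h : Heap Addr V) (a : Addr) (p : Perm) (v : V) :
    Heap Addr V where
  cell := fun b => if b = a then some (p, v) else h.cell b
  finite_dom := by
    refine (h.finite_dom.insert a).subset fun b hb => ?_
    by_cases hba : b = a
    · exact Or.inl hba
    · right
      simpa [hba] using hb

open Classical in
/-- The heap obtained from `h` by removing `a` from the domain. -/
noncomputable def Heap.erase {Addr V : Type*} (h : Heap Addr V) (a : Addr) : Heap Addr V where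
  cell := fun b => if b = a then none else h.cell b
  finite_dom := by
    refine h.finite_dom.subset fun b hb => ?_
    by_cases hba : b = a
    · simp [hba] at hb
    · simpa [hba] using hb

/-- The heap with domain `{a}` that maps `a` to `(p, v)`. -/
noncomputable def Heap.single {Addr V : Type*} (a : Addr) (p : Perm) (v : V) : Heap Addr V :=
  Heap.empty.set a p v

/-- Addition of heaps at one address: `CellSum c d e` says that `c + d` is defined and equals `e`.
Two cells can be added if their values agree and their permissions sum up to at most `1`. -/
def CellSum {V : Type*} : Option (Perm × V) → Option (Perm × V) → Option (Perm × V) → Prop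
  | none, d, e => e = d
  | some c, none, e => e = some c
  | some c, some d, e =>
      c.2 = d.2 ∧ ∃ r : Perm, (r : ℝ) = (c.1 : ℝ) + (d.1 : ℝ) ∧ e = some (r, c.2)

/-- `IsSum h₁ h₂ h` says that the sum `h₁ ⊕ h₂` is defined and equals `h`. -/
def IsSum {Addr V : Type*} (h₁ h₂ h : Heap Addr V) : Prop :=
  ∀ a, CellSum (h₁.cell a) (h₂.cell a) (h.cell a)

/-- Normal heaps assign the full permission to every address of their domain. -/
def NormHeap (Addr V : Type*) : Type _ :=
  {h : Heap Addr V // ∀ a c, h.cell a = some c → c.1 = Perm.full}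

/-- The value stored at `a`, if `a` is in the domain. -/
def NormHeap.val? {Addr V : Type*} (h : NormHeap Addr V) (a : Addr) : Option V :=
  (h.1.cell a).map Prod.snd

/-- The domain of a normal heap. -/
def NormHeap.dom {Addr V : Type*} (h : NormHeap Addr V) : Set Addr := h.1.dom

/-- The normal heap `h[a := v]`. -/
noncomputable def NormHeap.set {Addr V : Type*} (h : NormHeap Addr V) (a : Addr) (v : V) :
    NormHeap Addr V :=
  ⟨h.1.set a Perm.full v, by
    intro b c hc
    by_cases hba : b = a
    · simp only [Heap.set, hba, if_true, Option.some.injEq] at hc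
      rw [← hc]
    · simp only [Heap.set, hba, if_false] at hc
      exact h.2 b c hc⟩

/-- The normal heap obtained from `h` by removing `a` from the domain. -/
noncomputable def NormHeap.erase {Addr V : Type*} (h : NormHeap Addr V) (a : Addr) :
    NormHeap Addr V :=
  ⟨h.1.erase a, by
    intro b c hc
    by_cases hba : b = a
    · simp [Heap.erase, hba] at hc
    · simp only [Heap.erase, hba, if_false] at hc
      exact h.2 b c hc⟩

/-! ### Commands -/

/-- Lock identifiers: the locks available to programmers, the ghost lock `ghost` that protects the
state of the abstract model, and the ghost lock `marker` that records initialization. -/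
inductive LockId (Lk : Type*) where
  | user (l : Lk)
  | ghost
  | marker

/-- Commands. -/
inductive Cmd (Var V Lk : Type*) where
  | skip
  /-- `x := E` -/
  | assign (x : Var) (E : Expr Var V)
  /-- `[E] := E'` -/
  | write (E E' : Expr Var V)
  /-- `x := [E]` -/
  | read (x : Var) (E : Expr Var V)
  /-- `free(E)` -/
  | free (E : Expr Var V)
  /-- `x := new(E)` -/
  | new (x : Var) (E : Expr Var V)
  /-- `C₁; C₂` -/
  | seq (C₁ C₂ : Cmd Var V Lk)
  /-- `if E {C₁} else {C₂}` -/
  | ite (E : Expr Var V) (C₁ C₂ : Cmd Var V Lk)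
  /-- `while E {C}` -/
  | loop (E : Expr Var V) (C : Cmd Var V Lk)
  /-- `C₁ ∥ C₂` -/
  | par (C₁ C₂ : Cmd Var V Lk)
  /-- `lock L {C}`: declare the lock `L` -/
  | lock (L : LockId Lk) (C : Cmd Var V Lk)
  /-- `with L when E {C}`: conditional critical region -/
  | withLock (L : LockId Lk) (E : Expr Var V) (C : Cmd Var V Lk)
  /-- `within L {C}`: internal command, `C` is running and holds the lock `L` -/
  | within (L : LockId Lk) (C : Cmd Var V Lk)
  /-- `print(E)` -/
  | print (E : Expr Var V)
  /-- `Init {C}` -/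
  | init (C : Cmd Var V Lk)
  /-- `Next {C}` -/
  | next (C : Cmd Var V Lk)

section Syntactic

variable {Addr Var V Lk : Type*}

/-- The set of all sub-commands of a command, including the command itself. -/
def Cmd.subs : Cmd Var V Lk → Set (Cmd Var V Lk)
  | .seq C₁ C₂ => {.seq C₁ C₂} ∪ C₁.subs ∪ C₂.subs
  | .ite E C₁ C₂ => {.ite E C₁ C₂} ∪ C₁.subs ∪ C₂.subs
  | .loop E C => {.loop E C} ∪ C.subs
  | .par C₁ C₂ => {.par C₁ C₂} ∪ C₁.subs ∪ C₂.subs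
  | .lock L C => {.lock L C} ∪ C.subs
  | .withLock L E C => {.withLock L E C} ∪ C.subs
  | .within L C => {.within L C} ∪ C.subs
  | .init C => {.init C} ∪ C.subs
  | .next C => {.next C} ∪ C.subs
  | C => {C}

/-- The locks that are declared in `C`. -/
def Cmd.declared (C : Cmd Var V Lk) : Set (LockId Lk) := {L | ∃ C', .lock L C' ∈ C.subs}

/-- The locks that are held by `C`. -/
def Cmd.locked (C : Cmd Var V Lk) : Set (LockId Lk) := {L | ∃ C', .within L C' ∈ C.subs}

/-- `C` is initialized: the ghost lock is declared in `C`. -/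
def Cmd.IsInit (C : Cmd Var V Lk) : Prop := LockId.ghost ∈ C.declared

/-- `C` never acquires or holds a lock: it contains no critical region. -/
def Cmd.LockFree (C : Cmd Var V Lk) : Prop :=
  (∀ L E C', .withLock L E C' ∉ C.subs) ∧ (∀ L C', .within L C' ∉ C.subs)

/-- `C` has the form `C₁; Init {C₂}`, where `C₁` contains no `Init` block. -/
def Cmd.ContinuouslyInitialized (C : Cmd Var V Lk) : Prop :=
  ∃ C₁ C₂ : Cmd Var V Lk, (∀ C', .init C' ∉ C₁.subs) ∧ C = .seq C₁ (.init C₂)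

/-- The free variables of a function of the stack (an expression or an assertion): the variables
on which its result depends. -/
def fv {α : Type*} (f : Stack Var V → α) : Set Var := {x | ∃ s v, f (s.set x v) ≠ f s}

/-- The variables modified by a command. -/
def Cmd.mod : Cmd Var V Lk → Set Var
  | .skip => ∅
  | .assign x _ => {x}
  | .write _ _ => ∅
  | .read x _ => {x}
  | .free _ => ∅
  | .new x _ => {x}
  | .seq C₁ C₂ => C₁.mod ∪ C₂.mod
  | .ite _ C₁ C₂ => C₁.mod ∪ C₂.mod
  | .loop _ C => C.mod
  | .par C₁ C₂ => C₁.mod ∪ C₂.mod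
  | .lock _ C => C.mod
  | .withLock _ _ C => C.mod
  | .within _ C => C.mod
  | .print _ => ∅
  | .init C => C.mod
  | .next C => C.mod

/-- The free variables of a command: all variables that it accesses. -/
def Cmd.vars : Cmd Var V Lk → Set Var
  | .skip => ∅
  | .assign x E => {x} ∪ fv E
  | .write E E' => fv E ∪ fv E'
  | .read x E => {x} ∪ fv E
  | .free E => fv E
  | .new x E => {x} ∪ fv E
  | .seq C₁ C₂ => C₁.vars ∪ C₂.vars
  | .ite E C₁ C₂ => fv E ∪ C₁.vars ∪ C₂.vars
  | .loop E C => fv E ∪ C.vars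
  | .par C₁ C₂ => C₁.vars ∪ C₂.vars
  | .lock _ C => C.vars
  | .withLock _ E C => fv E ∪ C.vars
  | .within _ C => C.vars
  | .print E => fv E
  | .init C => C.vars
  | .next C => C.vars

/-- The addresses that `C` can modify in its next step on stack `s`, outside of critical regions
that are not yet entered and of `Next` blocks. -/
def Cmd.writes (M : ValueModel Addr V) (stdOut : Addr) : Cmd Var V Lk → Stack Var V → Set Addr
  | .write E _, s => {a | E s = M.addr a}
  | .free E, s => {a | E s = M.addr a}
  | .print _, _ => {stdOut}
  | .seq C₁ _, s => C₁.writes M stdOut s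
  | .par C₁ C₂, s => C₁.writes M stdOut s ∪ C₂.writes M stdOut s
  | .lock _ C, s => C.writes M stdOut s
  | .within _ C, s => C.writes M stdOut s
  | _, _ => ∅

/-- The addresses that `C` can access (read or modify) in its next step on stack `s`, outside of
critical regions that are not yet entered and of `Next` blocks. -/
def Cmd.reads (M : ValueModel Addr V) (stdOut : Addr) : Cmd Var V Lk → Stack Var V → Set Addr
  | .write E _, s => {a | E s = M.addr a}
  | .read _ E, s => {a | E s = M.addr a}
  | .free E, s => {a | E s = M.addr a}
  | .print _, _ => {stdOut}
  | .seq C₁ _, s => C₁.reads M stdOut s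
  | .par C₁ C₂, s => C₁.reads M stdOut s ∪ C₂.reads M stdOut s
  | .lock _ C, s => C.reads M stdOut s
  | .within _ C, s => C.reads M stdOut s
  | _, _ => ∅

end Syntactic

/-! ### Operational semantics -/

/-- Program configurations. -/
inductive Conf (Addr Var V Lk : Type*) where
  | run (C : Cmd Var V Lk) (s : Stack Var V) (h : NormHeap Addr V)
  | abort

section Semantics

variable {Addr Var V Lk : Type*}

mutual

/-- The small-step execution relation. The predicate `atomic` tells which commands are atomic. -/
inductive Step (M : ValueModel Addr V) (stdOut : Addr) (atomic : Cmd Var V Lk → Prop) :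
    Conf Addr Var V Lk → Conf Addr Var V Lk → Prop
  | assign (x E s h) :
      Step M stdOut atomic (.run (.assign x E) s h) (.run .skip (s.set x (E s)) h)
  | read (x E s h a v) : E s = M.addr a → h.val? a = some v →
      Step M stdOut atomic (.run (.read x E) s h) (.run .skip (s.set x v) h)
  | readA (x E s h) : (∀ a ∈ h.dom, E s ≠ M.addr a) →
      Step M stdOut atomic (.run (.read x E) s h) .abort
  | write (E E' s h a) : E s = M.addr a → a ∈ h.dom →
      Step M stdOut atomic (.run (.write E E') s h) (.run .skip s (h.set a (E' s)))
  | writeA (E E' s h) : (∀ a ∈ h.dom, E s ≠ M.addr a) →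
      Step M stdOut atomic (.run (.write E E') s h) .abort
  | new (x E s h a) : a ∉ h.dom →
      Step M stdOut atomic (.run (.new x E) s h)
        (.run .skip (s.set x (M.addr a)) (h.set a (E s)))
  | free (E s h a) : E s = M.addr a → a ∈ h.dom →
      Step M stdOut atomic (.run (.free E) s h) (.run .skip s (h.erase a))
  | freeA (E s h) : (∀ a ∈ h.dom, E s ≠ M.addr a) →
      Step M stdOut atomic (.run (.free E) s h) .abort
  | withLock (L E C s h) : E s = M.bool true →
      Step M stdOut atomic (.run (.withLock L E C) s h) (.run (.within L C) s h)
  | iteTrue (E C₁ C₂ s h) : E s = M.bool true →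
      Step M stdOut atomic (.run (.ite E C₁ C₂) s h) (.run C₁ s h)
  | iteFalse (E C₁ C₂ s h) : E s = M.bool false →
      Step M stdOut atomic (.run (.ite E C₁ C₂) s h) (.run C₂ s h)
  | loop (E C s h) :
      Step M stdOut atomic (.run (.loop E C) s h) (.run (.ite E (.seq C (.loop E C)) .skip) s h)
  | withinL (L C s h) : L ∈ C.locked →
      Step M stdOut atomic (.run (.within L C) s h) .abort
  | withinS (L s h) :
      Step M stdOut atomic (.run (.within L .skip) s h) (.run .skip s h)
  | seqS (C₂ s h) :
      Step M stdOut atomic (.run (.seq .skip C₂) s h) (.run C₂ s h)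
  | lockS (L s h) :
      Step M stdOut atomic (.run (.lock L .skip) s h) (.run .skip s h)
  | parS (s h) :
      Step M stdOut atomic (.run (.par .skip .skip) s h) (.run .skip s h)
  | seq (C₁ C₁' C₂ s s' h h') :
      Step M stdOut atomic (.run C₁ s h) (.run C₁' s' h') →
      Step M stdOut atomic (.run (.seq C₁ C₂) s h) (.run (.seq C₁' C₂) s' h')
  | seqA (C₁ C₂ s h) :
      Step M stdOut atomic (.run C₁ s h) .abort →
      Step M stdOut atomic (.run (.seq C₁ C₂) s h) .abort
  | par1 (C₁ C₁' C₂ s s' h h') :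
      Step M stdOut atomic (.run C₁ s h) (.run C₁' s' h') →
      C₁'.locked ∩ C₂.locked = ∅ →
      Step M stdOut atomic (.run (.par C₁ C₂) s h) (.run (.par C₁' C₂) s' h')
  | par1A (C₁ C₂ s h) :
      Step M stdOut atomic (.run C₁ s h) .abort →
      Step M stdOut atomic (.run (.par C₁ C₂) s h) .abort
  | par2 (C₁ C₂ C₂' s s' h h') :
      Step M stdOut atomic (.run C₂ s h) (.run C₂' s' h') →
      C₁.locked ∩ C₂'.locked = ∅ →
      Step M stdOut atomic (.run (.par C₁ C₂) s h) (.run (.par C₁ C₂') s' h')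
  | par2A (C₁ C₂ s h) :
      Step M stdOut atomic (.run C₂ s h) .abort →
      Step M stdOut atomic (.run (.par C₁ C₂) s h) .abort
  | race (C₁ C₂ s h) :
      ((C₁.reads M stdOut s ∩ C₂.writes M stdOut s) ∪
        (C₁.writes M stdOut s ∩ C₂.reads M stdOut s)).Nonempty →
      Step M stdOut atomic (.run (.par C₁ C₂) s h) .abort
  | lock (L C C' s s' h h') :
      Step M stdOut atomic (.run C s h) (.run C' s' h') →
      Step M stdOut atomic (.run (.lock L C) s h) (.run (.lock L C') s' h')
  | lockA (L C s h) :
      Step M stdOut atomic (.run C s h) .abort →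
      Step M stdOut atomic (.run (.lock L C) s h) .abort
  | within (L C C' s s' h h') :
      Step M stdOut atomic (.run C s h) (.run C' s' h') →
      Step M stdOut atomic (.run (.within L C) s h) (.run (.within L C') s' h')
  | withinA (L C s h) :
      Step M stdOut atomic (.run C s h) .abort →
      Step M stdOut atomic (.run (.within L C) s h) .abort
  | print (E s h v) : h.val? stdOut = some v →
      Step M stdOut atomic (.run (.print E) s h)
        (.run .skip s (h.set stdOut (M.append (E s) v)))
  | printA (E s h) : stdOut ∉ h.dom →
      Step M stdOut atomic (.run (.print E) s h) .abort
  | init (C s h) :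
      Step M stdOut atomic (.run (.init C) s h) (.run (.lock .ghost C) s h)
  | next (C s s' h h') : atomic C →
      Steps M stdOut atomic (.run C s h) (.run .skip s' h') →
      Step M stdOut atomic (.run (.next C) s h) (.run .skip s' h')

/-- The reflexive and transitive closure of `Step`. -/
inductive Steps (M : ValueModel Addr V) (stdOut : Addr) (atomic : Cmd Var V Lk → Prop) :
    Conf Addr Var V Lk → Conf Addr Var V Lk → Prop
  | refl (c) : Steps M stdOut atomic c c
  | head (c c' c'') : Step M stdOut atomic c c' → Steps M stdOut atomic c' c'' →
      Steps M stdOut atomic c c''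

end

open Classical in
/-- The observable state of a configuration: the content of the output stream if the configuration
is initialized. An output stream outside the domain of the heap is observed as `none`. -/
noncomputable def Conf.obs (stdOut : Addr) : Conf Addr Var V Lk → List (Option V)
  | .run C _ h => if C.IsInit then [h.val? stdOut] else []
  | .abort => []

/-- The observable traces of the finite executions that start in a configuration in `I`. -/
def traces (M : ValueModel Addr V) (stdOut : Addr) (atomic : Cmd Var V Lk → Prop)
    (I : Set (Conf Addr Var V Lk)) : Set (List (Option V)) :=
  {τ | ∃ (c : Conf Addr Var V Lk) (l : List (Conf Addr Var V Lk)), c ∈ I ∧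
    List.IsChain (Step M stdOut atomic) (c :: l) ∧ τ = (c :: l).flatMap (Conf.obs stdOut)}

end Semantics

/-! ### Assertions -/

/-- Assertions are identified with the sets of stack-heap pairs that satisfy them. -/
abbrev Assertion (Addr Var V : Type*) := Stack Var V → Heap Addr V → Prop

namespace Assertion

variable {Addr Var V : Type*}

/-- Conjunction. -/
def and (P Q : Assertion Addr Var V) : Assertion Addr Var V := fun s h => P s h ∧ Q s h

/-- Disjunction. -/
def or (P Q : Assertion Addr Var V) : Assertion Addr Var V := fun s h => P s h ∨ Q s h

/-- Negation. -/
def not (P : Assertion Addr Var V) : Assertion Addr Var V := fun s h => ¬ P s h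

/-- The assertion that is always true. -/
def top : Assertion Addr Var V := fun _ _ => True

/-- `∃ x. P`, where `x` is a program variable. -/
def ex (x : Var) (P : Assertion Addr Var V) : Assertion Addr Var V :=
  fun s h => ∃ v, P (s.set x v) h

/-- A Boolean expression as an assertion. -/
def expr (M : ValueModel Addr V) (E : Expr Var V) : Assertion Addr Var V :=
  fun s _ => E s = M.bool true

/-- The equality `x = E` of a variable and an expression. -/
def varEq (x : Var) (E : Expr Var V) : Assertion Addr Var V := fun s _ => s x = E s

/-- The heap is empty. -/
def emp : Assertion Addr Var V := fun _ h => h = Heap.empty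

/-- Points-to: the heap consists of exactly the address `E`, with permission `p` and value `E'`. -/
def pt (M : ValueModel Addr V) (E : Expr Var V) (p : Perm) (E' : Expr Var V) :
    Assertion Addr Var V :=
  fun s h => ∃ a, E s = M.addr a ∧ h = Heap.single a p (E' s)

/-- Separating conjunction. -/
def star (P Q : Assertion Addr Var V) : Assertion Addr Var V :=
  fun s h => ∃ h₁ h₂, IsSum h₁ h₂ h ∧ P s h₁ ∧ Q s h₂

/-- Iterated separating conjunction over a finite index set. -/
inductive bigStar {ι : Type*} (P : ι → Assertion Addr Var V) (s : Stack Var V) :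
    Set ι → Heap Addr V → Prop
  | empty (h : Heap Addr V) : bigStar P s ∅ h
  | step (I : Set ι) (j : ι) (h₁ h₂ h : Heap Addr V) : j ∈ I → IsSum h₁ h₂ h → P j s h₁ →
      bigStar P s (I \ {j}) h₂ → bigStar P s I h

/-- The heap contains at least permission `p` to the address `E`, with value `E'`. -/
def apt (M : ValueModel Addr V) (E : Expr Var V) (p : Perm) (E' : Expr Var V) :
    Assertion Addr Var V :=
  star (pt M E p E') top

/-- The heap consists of exactly the address `E`, with permission `p` and any value. -/
def alloc (M : ValueModel Addr V) (E : Expr Var V) (p : Perm) : Assertion Addr Var V :=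
  fun s h => ∃ v, pt M E p (fun _ => v) s h

/-- The heap contains at least permission `p` to the address `E`, with any value. -/
def acc (M : ValueModel Addr V) (E : Expr Var V) (p : Perm) : Assertion Addr Var V :=
  fun s h => ∃ v, apt M E p (fun _ => v) s h

/-- The substitution `P[x := E]`. -/
def subst (P : Assertion Addr Var V) (x : Var) (E : Expr Var V) : Assertion Addr Var V :=
  fun s h => P (s.set x (E s)) h

/-- The entailment `P ⇒ Q` is valid. -/
def Entails (P Q : Assertion Addr Var V) : Prop := ∀ s h, P s h → Q s h

/-- Precise assertions hold for at most one sub-heap of any heap. -/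
def Precise (P : Assertion Addr Var V) : Prop :=
  ∀ s h₁ h₂ h₁' h₂' h, IsSum h₁ h₂ h → IsSum h₁' h₂' h → P s h₁ → P s h₁' → h₁ = h₁'

end Assertion

/-! ### Abstract transition systems and their encoding in the heap -/

/-- An abstract transition system with `k ≥ 1` variables over the values `V`. Its initial state
formula and its next state formula are given as predicates on the values of the variables. -/
structure ATS (V : Type*) where
  k : ℕ
  k_pos : 0 < k
  init : (Fin k → V) → Prop
  next : (Fin k → V) → (Fin k → V) → Prop

namespace ATS

variable {V : Type*}

/-- The index of the observable variable, the first one. -/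
def fst (T : ATS V) : Fin T.k := ⟨0, T.k_pos⟩

/-- Every transition system considered here admits stuttering. -/
def StutterInvariant (T : ATS V) : Prop := ∀ σ, T.next σ σ

/-- The finite non-empty paths, which start in an initial state. -/
def IsPath (T : ATS V) : List (Fin T.k → V) → Prop
  | [] => False
  | σ :: l => T.init σ ∧ List.IsChain T.next (σ :: l)

/-- The observable traces: the empty trace and the projections of the paths to the observable
variable. -/
def traces (T : ATS V) : Set (List V) :=
  {τ | τ = [] ∨ ∃ l, T.IsPath l ∧ τ = l.map fun σ => σ T.fst}

end ATS

/-- The ghost addresses, and the encoding of the variables of a transition system as pairwise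
different ghost addresses. -/
structure Encoding (Addr : Type*) (k : ℕ) where
  ghostAddrs : Set Addr
  loc : Fin k ↪ Addr
  loc_mem : ∀ i, loc i ∈ ghostAddrs

/-- The address of the observable variable. -/
def Encoding.stdOut {Addr V : Type*} {T : ATS V} (e : Encoding Addr T.k) : Addr := e.loc T.fst

section Logic

variable {Addr Var V Lk : Type*}

open Assertion

/-- The assertion that the variables of the transition system have the values `y`, with permission
at least `p` to each of their addresses. -/
def absState (M : ValueModel Addr V) {k : ℕ} (e : Encoding Addr k) (p : Perm)
    (y : Fin k → Expr Var V) : Assertion Addr Var V :=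
  fun s h => bigStar (fun i => apt M (fun _ => M.addr (e.loc i)) p (y i)) s Set.univ h

/-- `G` contains permission `p` to the address of every variable of the transition system. -/
def Protects (M : ValueModel Addr V) {k : ℕ} (e : Encoding Addr k) (p : Perm)
    (G : Assertion Addr Var V) : Prop :=
  ∀ s h, G s h → bigStar (fun i => acc M (fun _ => M.addr (e.loc i)) p) s Set.univ h

/-- Lock environments: finitely many locks with their invariants. -/
abbrev LockEnv (Addr Var V Lk : Type*) := LockId Lk → Option (Assertion Addr Var V)

/-- The environment `Γ, L : R`. -/
noncomputable def LockEnv.extend (Γ : LockEnv Addr Var V Lk) (L : LockId Lk)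
    (R : Assertion Addr Var V) : LockEnv Addr Var V Lk :=
  open Classical in fun L' => if L' = L then some R else Γ L'

/-- The invariant of the lock `L`, which is `emp` if `L` does not occur in the environment. -/
def LockEnv.inv (Γ : LockEnv Addr Var V Lk) (L : LockId Lk) : Assertion Addr Var V :=
  (Γ L).getD emp

/-- The free variables of a lock environment. -/
def LockEnv.fv (Γ : LockEnv Addr Var V Lk) : Set Var := ⋃ L, CSLRef.fv (Γ.inv L)

/-- The judgments `Γ ⊢ {P} C {Q}` that are derivable in the refinement logic for the transition
system `T`. As usual, `Γ, L : R` is formed only if `L` does not occur in `Γ`. -/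
inductive Derives (M : ValueModel Addr V) (T : ATS V) (e : Encoding Addr T.k)
    (atomic : Cmd Var V Lk → Prop) :
    LockEnv Addr Var V Lk → Assertion Addr Var V → Cmd Var V Lk → Assertion Addr Var V → Prop
  | skip (Γ P) : Derives M T e atomic Γ P .skip P
  | assign (Γ P x E) : x ∉ Γ.fv →
      Derives M T e atomic Γ (subst P x E) (.assign x E) P
  | write (Γ E E') :
      Derives M T e atomic Γ (alloc M E Perm.full) (.write E E') (pt M E Perm.full E')
  | read (Γ x E E' p) : x ∉ fv E ∪ fv E' ∪ Γ.fv →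
      Derives M T e atomic Γ (pt M E p E') (.read x E) (and (pt M E p E') (varEq x E'))
  | new (Γ x E) : x ∉ Γ.fv ∪ fv E →
      Derives M T e atomic Γ emp (.new x E) (pt M (fun s => s x) Perm.full E)
  | free (Γ E) :
      Derives M T e atomic Γ
        (and (alloc M E Perm.full) (fun s _ => ∀ a ∈ e.ghostAddrs, E s ≠ M.addr a))
        (.free E) emp
  | seq (Γ P R Q C₁ C₂) :
      Derives M T e atomic Γ P C₁ R → Derives M T e atomic Γ R C₂ Q →
      Derives M T e atomic Γ P (.seq C₁ C₂) Q
  | cond (Γ P Q E C₁ C₂) :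
      Derives M T e atomic Γ (and P (expr M E)) C₁ Q →
      Derives M T e atomic Γ (and P (not (expr M E))) C₂ Q →
      Derives M T e atomic Γ P (.ite E C₁ C₂) Q
  | loop (Γ I E C) :
      Derives M T e atomic Γ (and I (expr M E)) C I →
      Derives M T e atomic Γ I (.loop E C) (and I (not (expr M E)))
  | par (Γ P₁ P₂ Q₁ Q₂ C₁ C₂) :
      Derives M T e atomic Γ P₁ C₁ Q₁ →
      (fv P₁ ∪ C₁.vars ∪ fv Q₁ ∪ Γ.fv) ∩ C₂.mod = ∅ →
      Derives M T e atomic Γ P₂ C₂ Q₂ →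
      (fv P₂ ∪ C₂.vars ∪ fv Q₂ ∪ Γ.fv) ∩ C₁.mod = ∅ →
      Derives M T e atomic Γ (star P₁ P₂) (.par C₁ C₂) (star Q₁ Q₂)
  | lock (Γ l R P Q C) : Γ (.user l) = none →
      Derives M T e atomic (Γ.extend (.user l) R) P C Q →
      Derives M T e atomic Γ (star R P) (.lock (.user l) C) (star R Q)
  | withLock (Γ l R P Q E C) : Γ (.user l) = none →
      Derives M T e atomic Γ (and (star P R) (expr M E)) C (star Q R) →
      Derives M T e atomic (Γ.extend (.user l) R) P (.withLock (.user l) E C) Q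
  | frame (Γ P Q R C) : fv R ∩ C.mod = ∅ →
      Derives M T e atomic Γ P C Q →
      Derives M T e atomic Γ (star P R) C (star Q R)
  | cons (Γ P P' Q Q' C) : Entails P' P → Entails Q Q' →
      Derives M T e atomic Γ P C Q →
      Derives M T e atomic Γ P' C Q'
  | ex (Γ x P Q C) : x ∉ C.vars ∪ Γ.fv →
      Derives M T e atomic Γ P C Q →
      Derives M T e atomic Γ (ex x P) C (ex x Q)
  | conj (Γ P₁ P₂ Q₁ Q₂ C) : (∀ L, Precise (Γ.inv L)) →
      Derives M T e atomic Γ P₁ C Q₁ → Derives M T e atomic Γ P₂ C Q₂ →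
      Derives M T e atomic Γ (and P₁ P₂) C (and Q₁ Q₂)
  | disj (Γ P₁ P₂ Q₁ Q₂ C) :
      Derives M T e atomic Γ P₁ C Q₁ → Derives M T e atomic Γ P₂ C Q₂ →
      Derives M T e atomic Γ (or P₁ P₂) C (or Q₁ Q₂)
  | init (Γ G p P Q C) : Γ .ghost = none → Γ .marker = none → Protects M e p G →
      Derives M T e atomic ((Γ.extend .ghost G).extend .marker emp) P C Q →
      Derives M T e atomic Γ
        (star (fun s h => ∃ y : Fin T.k → V,
          absState M e p (fun i _ => y i) s h ∧ T.init y ∧ G s h) P)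
        (.init C) (star G Q)
  | next (Γ G p P Q C) (o : Fin T.k → Var) : Γ .ghost = none → Protects M e p G → atomic C →
      Function.Injective o →
      (∀ i, o i ∉ fv P ∪ fv Q ∪ fv G ∪ Γ.fv ∪ C.vars) →
      Derives M T e atomic Γ
        (star (and (absState M e p (fun i s => s (o i))) G) P) C
        (star (fun s h => ∃ y : Fin T.k → V,
          absState M e p (fun i _ => y i) s h ∧ T.next (fun i => s (o i)) y ∧ G s h) Q) →
      Derives M T e atomic (Γ.extend .ghost G) P (.next C) Q
  | print (Γ : LockEnv Addr Var V Lk) (E E' : Expr Var V) : Γ .marker = none →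
      Derives M T e atomic (Γ.extend .marker emp)
        (pt M (fun _ => M.addr e.stdOut) Perm.full E') (.print E)
        (pt M (fun _ => M.addr e.stdOut) Perm.full (fun s => M.append (E s) (E' s)))

/-- The initial configurations: a part of the heap satisfies `P`, another part satisfies the
invariants of all locks that are not held, and the rest of the heap is arbitrary. -/
def initialConfs (C : Cmd Var V Lk) (P : Assertion Addr Var V) (Γ : LockEnv Addr Var V Lk) :
    Set (Conf Addr Var V Lk) :=
  {c | ∃ (s : Stack Var V) (g : NormHeap Addr V) (h hS hF hhS : Heap Addr V),
    c = .run C s g ∧ IsSum h hS hhS ∧ IsSum hhS hF g.1 ∧ P s h ∧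
    bigStar Γ.inv s (Set.univ \ C.locked) hS}

end Logic

end CSLRef

open CSLRef

/-!
Soundness is proved semantically. A heap `h` is represented by its permission function
`h.raw : Addr → V → ℝ`; a sum of heaps is defined exactly if the pointwise sum of the permission
functions is again one (`isSum_iff`), and every part of such a sum is a heap (`Heap.exists_raw_eq`).
All reasoning about separation is thereby reduced to linear equations between functions.

The judgment `Γ ⊢ {P} C {Q}` is interpreted by the step-indexed predicate `Safe`: whenever the
global heap splits into the local heap of `C`, the resources of the locks that nobody holds
(`Shared`), and a frame, every step of `C` leads to such a split again, with the same frame. In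
addition, the step meets the obligations `Refines`: if the invariant of the ghost lock protects the
abstract state, then the abstract states before and after the step are related by the transition
relation. Two observations make this work.

* A step that leaves the resources of the locks alone cannot change the abstract state
  (`Refines.of_shared_eq`). The ghost lock is never held, so its invariant is always among these
  resources, and it owns a positive permission for each part of the abstract state, whereas an
  allocated address is changed only by the owner of its full permission. Hence all steps except
  those of `Next` blocks stutter.
* A `Next` block executes a command without critical regions in one go, so that the invariant of
  the ghost lock may be lent to this command. As the logical variables in the triple of the command
  are fresh, the execution can be replayed from a stack on which they record the current abstract
  state (`Safe.next`); the postcondition then states the transition.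

Each rule preserves safety, so derivable judgments describe safe commands (`Derives.safe`). An
execution of `C₁; Init {C₂}` is unobservable until the `Init` block declares the ghost lock, at which
point the abstract state is initial, and from then on it follows a path of the transition system
(`SafeConf.exists_chain`). Aborted configurations are unobservable, so that neither the absence of
memory faults nor that of data races has to be established.
-/

namespace CSLRef

open Assertion

/-! ### Heaps as permission functions -/

section HeapAlgebra

variable {Addr V : Type*}

open Classical in
/-- The permission function of a heap: the permission that `h` holds for the address `a` with
value `v`, and `0` if `h` does not store `v` at `a`. -/
noncomputable def Heap.raw (h : Heap Addr V) (a : Addr) (v : V) : ℝ :=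
  match h.cell a with
  | none => 0
  | some c => if v = c.2 then (c.1 : ℝ) else 0

theorem Heap.raw_of_none {h : Heap Addr V} {a : Addr} (ha : h.cell a = none) (v : V) :
    h.raw a v = 0 := by
  simp [Heap.raw, ha]

open Classical in
theorem Heap.raw_of_some {h : Heap Addr V} {a : Addr} {c : Perm × V} (ha : h.cell a = some c)
    (v : V) : h.raw a v = if v = c.2 then (c.1 : ℝ) else 0 := by
  simp [Heap.raw, ha]

theorem Heap.raw_nonneg (h : Heap Addr V) : 0 ≤ h.raw := by
  intro a v
  rcases hc : h.cell a with _ | c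
  · simp [Heap.raw_of_none hc]
  · rw [Heap.raw_of_some hc]
    split_ifs
    · exact c.1.2.1.le
    · exact le_rfl

theorem Heap.raw_pos_iff {h : Heap Addr V} {a : Addr} {v : V} :
    0 < h.raw a v ↔ ∃ q, h.cell a = some (q, v) := by
  rcases hc : h.cell a with _ | c
  · simp [Heap.raw_of_none hc]
  · rw [Heap.raw_of_some hc]
    split_ifs with hv
    · subst hv
      exact ⟨fun _ => ⟨c.1, rfl⟩, fun _ => c.1.2.1⟩
    · simp only [lt_self_iff_false, Option.some.injEq, false_iff, not_exists]
      rintro q rfl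
      exact hv rfl

theorem Heap.raw_of_cell {h : Heap Addr V} {a : Addr} {q : Perm} {v : V}
    (hc : h.cell a = some (q, v)) : h.raw a v = q := by
  rw [Heap.raw_of_some hc]; simp

theorem Heap.raw_of_cell_ne {h : Heap Addr V} {a : Addr} {q : Perm} {v w : V}
    (hc : h.cell a = some (q, v)) (hw : w ≠ v) : h.raw a w = 0 := by
  rw [Heap.raw_of_some hc]; simp [hw]

theorem Heap.raw_injective : Function.Injective (Heap.raw : Heap Addr V → Addr → V → ℝ) := by
  intro h₁ h₂ heq
  ext1
  funext a
  have key : ∀ q v, h₁.cell a = some (q, v) ↔ h₂.cell a = some (q, v) := by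
    have aux : ∀ h h' : Heap Addr V, h.raw = h'.raw → ∀ q v, h.cell a = some (q, v) →
        h'.cell a = some (q, v) := by
      intro h h' heq q v hq
      have h1 : h.raw a v = q := Heap.raw_of_cell hq
      have h2 : 0 < h'.raw a v := by
        rw [← heq, h1]; exact q.2.1
      obtain ⟨q', hq'⟩ := Heap.raw_pos_iff.1 h2
      have h3 := Heap.raw_of_cell hq'
      rw [← heq, h1] at h3
      rw [hq', Subtype.ext h3]
    exact fun q v => ⟨aux _ _ heq q v, aux _ _ heq.symm q v⟩
  rcases h1 : h₁.cell a with _ | ⟨q, v⟩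
  · rcases h2 : h₂.cell a with _ | ⟨q, v⟩
    · rfl
    · rw [(key q v).2 h2] at h1; cases h1
  · rw [(key q v).1 h1]

theorem isSum_iff {h₁ h₂ h : Heap Addr V} : IsSum h₁ h₂ h ↔ h.raw = h₁.raw + h₂.raw := by
  constructor
  · intro hs
    funext a v
    have ha := hs a
    simp only [Pi.add_apply, Heap.raw]
    generalize h.cell a = e, h₁.cell a = c, h₂.cell a = d at ha
    rcases c with _ | c <;> rcases d with _ | d <;> simp only [CellSum] at ha
    · simp [ha]
    · simp [ha]
    · simp [ha]
    · obtain ⟨h1, r, hr, h2⟩ := ha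
      subst h2
      by_cases hv : v = d.2 <;> simp [hv, hr, h1]
  · intro hs a
    have ha : ∀ v, h.raw a v = h₁.raw a v + h₂.raw a v := fun v => by rw [hs]; rfl
    rcases h1 : h₁.cell a with _ | ⟨q₁, v₁⟩
    · rcases h2 : h₂.cell a with _ | ⟨q₂, v₂⟩
      · simp only [CellSum]
        rcases h3 : h.cell a with _ | ⟨q, v⟩
        · rfl
        · have := ha v
          rw [Heap.raw_of_cell h3, Heap.raw_of_none h1, Heap.raw_of_none h2] at this
          have := q.2.1
          linarith
      · simp only [CellSum]
        have := ha v₂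
        rw [Heap.raw_of_none h1, Heap.raw_of_cell h2, zero_add] at this
        obtain ⟨q, hq⟩ := Heap.raw_pos_iff.1 (this ▸ q₂.2.1 : 0 < h.raw a v₂)
        rw [Heap.raw_of_cell hq] at this
        rw [hq, Subtype.ext this]
    · rcases h2 : h₂.cell a with _ | ⟨q₂, v₂⟩
      · simp only [CellSum]
        have := ha v₁
        rw [Heap.raw_of_none h2, Heap.raw_of_cell h1, add_zero] at this
        obtain ⟨q, hq⟩ := Heap.raw_pos_iff.1 (this ▸ q₁.2.1 : 0 < h.raw a v₁)
        rw [Heap.raw_of_cell hq] at this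
        rw [hq, Subtype.ext this]
      · simp only [CellSum]
        have e1 := ha v₁
        have e2 := ha v₂
        have n1 := h₁.raw_nonneg a v₂
        have n2 := h₂.raw_nonneg a v₁
        have p1 := q₁.2.1
        have p2 := q₂.2.1
        simp only [Pi.zero_apply] at n1 n2
        rw [Heap.raw_of_cell h1] at e1
        rw [Heap.raw_of_cell h2] at e2
        obtain ⟨q, hq⟩ := Heap.raw_pos_iff.1 (by linarith : 0 < h.raw a v₁)
        obtain ⟨q', hq'⟩ := Heap.raw_pos_iff.1 (by linarith : 0 < h.raw a v₂)
        obtain ⟨-, rfl⟩ : q = q' ∧ v₁ = v₂ := by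
          rw [hq] at hq'
          simpa using hq'
        refine ⟨rfl, q, ?_, hq⟩
        rw [Heap.raw_of_cell hq, Heap.raw_of_cell h2] at e1
        exact e1

@[simp]
theorem Heap.raw_empty : (Heap.empty : Heap Addr V).raw = 0 := by
  funext a v
  exact Heap.raw_of_none rfl v

open Classical in
theorem Heap.raw_set (h : Heap Addr V) (a : Addr) (p : Perm) (v : V) (b : Addr) (w : V) :
    (h.set a p v).raw b w = if b = a then (if w = v then (p : ℝ) else 0) else h.raw b w := by
  by_cases hb : b = a
  · rw [Heap.raw_of_some (c := (p, v)) (by simp [Heap.set, hb])]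
    simp [hb]
  · simp [Heap.raw, Heap.set, hb]

open Classical in
theorem Heap.raw_erase (h : Heap Addr V) (a : Addr) (b : Addr) (w : V) :
    (h.erase a).raw b w = if b = a then 0 else h.raw b w := by
  by_cases hb : b = a
  · rw [Heap.raw_of_none (by simp [Heap.erase, hb])]
    simp [hb]
  · simp [Heap.raw, Heap.erase, hb]

open Classical in
theorem Heap.raw_single (a : Addr) (p : Perm) (v : V) (b : Addr) (w : V) :
    (Heap.single a p v).raw b w = if b = a then (if w = v then (p : ℝ) else 0) else 0 := by
  rw [Heap.single, Heap.raw_set]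
  simp

/-- Every non-negative function below the permission function of a heap is a permission
function. In particular, the partial sums of a defined sum of heaps are defined. -/
theorem Heap.exists_raw_eq {g : Heap Addr V} {r : Addr → V → ℝ} (h0 : 0 ≤ r) (hr : r ≤ g.raw) :
    ∃ h : Heap Addr V, h.raw = r := by
  classical
  have hle : ∀ a q v, g.cell a = some (q, v) → r a v ≤ 1 := fun a q v hc =>
    (hr a v).trans (by rw [Heap.raw_of_cell hc]; exact q.2.2)
  have hz : ∀ a v, g.raw a v = 0 → r a v = 0 := fun a v hv =>
    le_antisymm ((hr a v).trans hv.le) (h0 a v)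
  let f : Addr → Option (Perm × V) := fun a =>
    if hp : ∃ v, 0 < r a v then
      some (⟨r a hp.choose, hp.choose_spec, by
        obtain ⟨q, hq⟩ := Heap.raw_pos_iff.1 (hp.choose_spec.trans_le (hr a _))
        exact hle a q _ hq⟩, hp.choose)
    else none
  have hfin : {a | f a ≠ none}.Finite := by
    refine g.finite_dom.subset fun a ha => ?_
    by_cases hp : ∃ v, 0 < r a v
    · obtain ⟨v, hv⟩ := hp
      obtain ⟨q, hq⟩ := Heap.raw_pos_iff.1 (hv.trans_le (hr a v))
      simp [hq]
    · simp [f, hp] at ha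
  refine ⟨⟨f, hfin⟩, ?_⟩
  funext a v
  by_cases hp : ∃ v, 0 < r a v
  · have hf : f a = some _ := dif_pos hp
    rw [Heap.raw_of_some hf]
    split_ifs with hv
    · rw [hv]
    · obtain ⟨q, hq⟩ := Heap.raw_pos_iff.1 (hp.choose_spec.trans_le (hr a _))
      exact (hz a v (Heap.raw_of_cell_ne hq hv)).symm
  · have hf : f a = none := dif_neg hp
    rw [Heap.raw_of_none hf]
    push Not at hp
    exact le_antisymm (h0 a v) (hp v)

/-- The sum of two parts of a heap is defined. -/
theorem Heap.exists_raw_add {g h₁ h₂ : Heap Addr V} {z : Addr → V → ℝ} (hz : 0 ≤ z)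
    (hg : g.raw = h₁.raw + h₂.raw + z) : ∃ h : Heap Addr V, h.raw = h₁.raw + h₂.raw :=
  Heap.exists_raw_eq (add_nonneg h₁.raw_nonneg h₂.raw_nonneg) (by
    rw [hg]; exact le_add_of_nonneg_right hz)

theorem NormHeap.val?_of_raw_pos {g : NormHeap Addr V} {a : Addr} {v : V} (h : 0 < g.1.raw a v) :
    g.val? a = some v := by
  obtain ⟨q, hq⟩ := Heap.raw_pos_iff.1 h
  simp [NormHeap.val?, hq]

/-- A part of a heap that has the full permission for an address excludes all other permissions
for this address. -/
theorem Heap.eq_zero_of_full {g : Heap Addr V} {a : Addr} {v : V} {z : Addr → V → ℝ}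
    (hz : 0 ≤ z) (hg : g.raw = (Heap.single a Perm.full v).raw + z) (w : V) : z a w = 0 := by
  have hv : g.raw a v = 1 + z a v := by
    rw [hg]; simp [Heap.raw_single, Perm.full]
  have h0 := hz a v
  have hw0 := hz a w
  simp only [Pi.zero_apply] at h0 hw0
  obtain ⟨q, hq⟩ := Heap.raw_pos_iff.1 (by linarith : 0 < g.raw a v)
  have h1 := q.2.2
  rw [Heap.raw_of_cell hq] at hv
  by_cases hwv : w = v
  · subst hwv; linarith
  · have hw : g.raw a w = z a w := by
      rw [hg]; simp [Heap.raw_single, hwv]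
    rw [← hw, Heap.raw_of_cell_ne hq hwv]

theorem NormHeap.raw_write {g : NormHeap Addr V} {a : Addr} {v : V} {z : Addr → V → ℝ}
    (hz : 0 ≤ z) (hg : g.1.raw = (Heap.single a Perm.full v).raw + z) (w : V) :
    (g.set a w).1.raw = (Heap.single a Perm.full w).raw + z := by
  funext b u
  simp only [NormHeap.set, Heap.raw_set, Pi.add_apply, Heap.raw_single]
  split_ifs with hb hu
  · subst hb; rw [Heap.eq_zero_of_full hz hg]; simp
  · subst hb; rw [Heap.eq_zero_of_full hz hg]; simp
  · rw [hg]; simp [Heap.raw_single, hb]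

theorem NormHeap.raw_new {g : NormHeap Addr V} {a : Addr} (ha : a ∉ g.dom) (w : V) :
    (g.set a w).1.raw = (Heap.single a Perm.full w).raw + g.1.raw := by
  have ha : g.1.cell a = none := by simpa [NormHeap.dom, Heap.dom] using ha
  funext b u
  simp only [NormHeap.set, Heap.raw_set, Pi.add_apply, Heap.raw_single]
  split_ifs with hb hu
  · subst hb; rw [Heap.raw_of_none ha]; simp
  · subst hb; rw [Heap.raw_of_none ha]; simp
  · simp

theorem NormHeap.raw_free {g : NormHeap Addr V} {a : Addr} {v : V} {z : Addr → V → ℝ}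
    (hz : 0 ≤ z) (hg : g.1.raw = (Heap.single a Perm.full v).raw + z) :
    (g.erase a).1.raw = z := by
  funext b u
  simp only [NormHeap.erase, Heap.raw_erase]
  split_ifs with hb
  · subst hb; rw [Heap.eq_zero_of_full hz hg]
  · rw [hg]; simp [Heap.raw_single, hb]

end HeapAlgebra

/-! ### Stacks and free variables -/

section Stacks

variable {Var V : Type*}

@[simp]
theorem Stack.set_self (s : Stack Var V) (x : Var) (v : V) : s.set x v x = v := by
  simp [Stack.set]

theorem Stack.set_of_ne (s : Stack Var V) {x y : Var} (v : V) (h : y ≠ x) : s.set x v y = s y := by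
  simp [Stack.set, h]

theorem Stack.set_set (s : Stack Var V) (x : Var) (v w : V) : (s.set x v).set x w = s.set x w := by
  funext y
  by_cases h : y = x <;> simp [Stack.set, h]

theorem Stack.set_eq_self (s : Stack Var V) (x : Var) : s.set x (s x) = s := by
  funext y
  by_cases h : y = x <;> simp [Stack.set, h]

theorem Stack.set_comm (s : Stack Var V) {x y : Var} (v w : V) (h : x ≠ y) :
    (s.set x v).set y w = (s.set y w).set x v := by
  funext z
  by_cases h1 : z = x
  · subst h1; simp [Stack.set, h]
  · by_cases h2 : z = y
    · subst h2; simp [Stack.set, h1]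
    · simp [Stack.set, h1, h2]

theorem apply_set_of_notMem_fv {α : Type*} {f : Stack Var V → α} {x : Var} (hx : x ∉ fv f)
    (s : Stack Var V) (v : V) : f (s.set x v) = f s := by
  by_contra h
  exact hx ⟨s, v, h⟩

/-- A property of stacks that is stable under updates of the variables in a finite set `F` is
transferred between stacks that agree outside of `F`. -/
theorem Stack.transfer {F : Set Var} (hF : F.Finite) {p : Stack Var V → Prop}
    (hp : ∀ s x v, x ∈ F → p s → p (s.set x v)) {s s' : Stack Var V}
    (hs : ∀ y, y ∉ F → s' y = s y) (h : p s) : p s' := by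
  induction F, hF using Set.Finite.induction_on generalizing s with
  | empty =>
    have : s' = s := funext fun y => hs y (by simp)
    rwa [this]
  | @insert x F hx hF ih =>
    refine ih (fun s y v hy => hp s y v (Or.inr hy)) (s := s.set x (s' x)) ?_
      (hp s x _ (Or.inl rfl) h)
    intro y hy
    by_cases hyx : y = x
    · subst hyx; simp
    · rw [Stack.set_of_ne _ _ hyx]
      exact hs y (by simp [hyx, hy])

theorem apply_eq_of_agree {α : Type*} {f : Stack Var V → α} {F : Set Var} (hF : F.Finite)
    (hf : ∀ x ∈ F, x ∉ fv f) {s s' : Stack Var V} (hs : ∀ y, y ∉ F → s' y = s y) : f s' = f s :=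
  Stack.transfer hF (p := fun t => f t = f s)
    (fun t x v hx ht => (apply_set_of_notMem_fv (hf x hx) t v).trans ht) hs rfl

end Stacks

/-! ### Syntactic invariants of execution -/

section ExecutionInvariants

variable {Addr Var V Lk : Type*}

theorem Cmd.mod_finite (C : Cmd Var V Lk) : C.mod.Finite := by
  induction C <;> simp_all [Cmd.mod]

theorem Cmd.mod_subset_vars (C : Cmd Var V Lk) : C.mod ⊆ C.vars := by
  induction C <;> simp only [Cmd.mod, Cmd.vars] <;> grind

section Locked

variable (x : Var) (E E' : Expr Var V) (C C₁ C₂ : Cmd Var V Lk) (L : LockId Lk)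

@[simp] theorem Cmd.locked_skip : (.skip : Cmd Var V Lk).locked = ∅ := by
  simp [Cmd.locked, Cmd.subs]
@[simp] theorem Cmd.locked_assign : (.assign x E : Cmd Var V Lk).locked = ∅ := by
  simp [Cmd.locked, Cmd.subs]
@[simp] theorem Cmd.locked_write : (.write E E' : Cmd Var V Lk).locked = ∅ := by
  simp [Cmd.locked, Cmd.subs]
@[simp] theorem Cmd.locked_read : (.read x E : Cmd Var V Lk).locked = ∅ := by
  simp [Cmd.locked, Cmd.subs]
@[simp] theorem Cmd.locked_free : (.free E : Cmd Var V Lk).locked = ∅ := by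
  simp [Cmd.locked, Cmd.subs]
@[simp] theorem Cmd.locked_new : (.new x E : Cmd Var V Lk).locked = ∅ := by
  simp [Cmd.locked, Cmd.subs]
@[simp] theorem Cmd.locked_print : (.print E : Cmd Var V Lk).locked = ∅ := by
  simp [Cmd.locked, Cmd.subs]
@[simp] theorem Cmd.locked_seq : (Cmd.seq C₁ C₂).locked = C₁.locked ∪ C₂.locked := by
  ext; simp [Cmd.locked, Cmd.subs, exists_or]
@[simp] theorem Cmd.locked_par : (Cmd.par C₁ C₂).locked = C₁.locked ∪ C₂.locked := by
  ext; simp [Cmd.locked, Cmd.subs, exists_or]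
@[simp] theorem Cmd.locked_ite : (Cmd.ite E C₁ C₂).locked = C₁.locked ∪ C₂.locked := by
  ext; simp [Cmd.locked, Cmd.subs, exists_or]
@[simp] theorem Cmd.locked_loop : (Cmd.loop E C).locked = C.locked := by
  ext; simp [Cmd.locked, Cmd.subs]
@[simp] theorem Cmd.locked_lock : (Cmd.lock L C).locked = C.locked := by
  ext; simp [Cmd.locked, Cmd.subs]
@[simp] theorem Cmd.locked_withLock : (Cmd.withLock L E C).locked = C.locked := by
  ext; simp [Cmd.locked, Cmd.subs]
@[simp] theorem Cmd.locked_within : (Cmd.within L C).locked = insert L C.locked := by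
  ext; simp [Cmd.locked, Cmd.subs, exists_or]
@[simp] theorem Cmd.locked_init : (Cmd.init C).locked = C.locked := by
  ext; simp [Cmd.locked, Cmd.subs]
@[simp] theorem Cmd.locked_next : (Cmd.next C).locked = C.locked := by
  ext; simp [Cmd.locked, Cmd.subs]

end Locked

theorem Cmd.LockFree.locked_eq_empty {C : Cmd Var V Lk} (h : C.LockFree) : C.locked = ∅ := by
  ext L
  simpa [Cmd.locked] using h.2 L

/-- `C` neither contains an `Init` block nor declares the ghost lock. Such a command is never
initialized. -/
def Cmd.NeverInit (C : Cmd Var V Lk) : Prop :=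
  (∀ C', .init C' ∉ C.subs) ∧ ∀ C', .lock .ghost C' ∉ C.subs

section NeverInit

variable (x : Var) (E E' : Expr Var V) (C C₁ C₂ : Cmd Var V Lk) (L : LockId Lk)

@[simp] theorem Cmd.neverInit_skip : (.skip : Cmd Var V Lk).NeverInit := by
  simp [Cmd.NeverInit, Cmd.subs]
@[simp] theorem Cmd.neverInit_seq : (Cmd.seq C₁ C₂).NeverInit ↔ C₁.NeverInit ∧ C₂.NeverInit := by
  simp only [Cmd.NeverInit, Cmd.subs, Set.mem_union, Set.mem_singleton_iff]; grind
@[simp] theorem Cmd.neverInit_par : (Cmd.par C₁ C₂).NeverInit ↔ C₁.NeverInit ∧ C₂.NeverInit := by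
  simp only [Cmd.NeverInit, Cmd.subs, Set.mem_union, Set.mem_singleton_iff]; grind
@[simp] theorem Cmd.neverInit_ite : (Cmd.ite E C₁ C₂).NeverInit ↔ C₁.NeverInit ∧ C₂.NeverInit := by
  simp only [Cmd.NeverInit, Cmd.subs, Set.mem_union, Set.mem_singleton_iff]; grind
@[simp] theorem Cmd.neverInit_loop : (Cmd.loop E C).NeverInit ↔ C.NeverInit := by
  simp [Cmd.NeverInit, Cmd.subs]
@[simp] theorem Cmd.neverInit_lock : (Cmd.lock L C).NeverInit ↔ L ≠ .ghost ∧ C.NeverInit := by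
  simp only [Cmd.NeverInit, Cmd.subs, Set.mem_union, Set.mem_singleton_iff, Cmd.lock.injEq]
  grind
@[simp] theorem Cmd.neverInit_withLock : (Cmd.withLock L E C).NeverInit ↔ C.NeverInit := by
  simp [Cmd.NeverInit, Cmd.subs]
@[simp] theorem Cmd.neverInit_within : (Cmd.within L C).NeverInit ↔ C.NeverInit := by
  simp [Cmd.NeverInit, Cmd.subs]
@[simp] theorem Cmd.neverInit_init : ¬ (Cmd.init C).NeverInit := fun h => h.1 C (by simp [Cmd.subs])

@[simp] theorem Cmd.lockFree_skip : (.skip : Cmd Var V Lk).LockFree := by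
  simp [Cmd.LockFree, Cmd.subs]
@[simp] theorem Cmd.lockFree_seq : (Cmd.seq C₁ C₂).LockFree ↔ C₁.LockFree ∧ C₂.LockFree := by
  simp only [Cmd.LockFree, Cmd.subs, Set.mem_union, Set.mem_singleton_iff]; grind
@[simp] theorem Cmd.lockFree_par : (Cmd.par C₁ C₂).LockFree ↔ C₁.LockFree ∧ C₂.LockFree := by
  simp only [Cmd.LockFree, Cmd.subs, Set.mem_union, Set.mem_singleton_iff]; grind
@[simp] theorem Cmd.lockFree_ite : (Cmd.ite E C₁ C₂).LockFree ↔ C₁.LockFree ∧ C₂.LockFree := by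
  simp only [Cmd.LockFree, Cmd.subs, Set.mem_union, Set.mem_singleton_iff]; grind
@[simp] theorem Cmd.lockFree_loop : (Cmd.loop E C).LockFree ↔ C.LockFree := by
  simp [Cmd.LockFree, Cmd.subs]
@[simp] theorem Cmd.lockFree_lock : (Cmd.lock L C).LockFree ↔ C.LockFree := by
  simp [Cmd.LockFree, Cmd.subs]
@[simp] theorem Cmd.not_lockFree_withLock : ¬ (Cmd.withLock L E C).LockFree :=
  fun h => h.1 L E C (by simp [Cmd.subs])
@[simp] theorem Cmd.not_lockFree_within : ¬ (Cmd.within L C).LockFree :=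
  fun h => h.2 L C (by simp [Cmd.subs])
@[simp] theorem Cmd.lockFree_init : (Cmd.init C).LockFree ↔ C.LockFree := by
  simp [Cmd.LockFree, Cmd.subs]

end NeverInit

/-- The syntactic relations between the two ends of an execution. An aborted execution never
resumes. -/
def ExecInvariant : Conf Addr Var V Lk → Conf Addr Var V Lk → Prop
  | .run C s _, .run C' s' _ =>
      C'.vars ⊆ C.vars ∧ C'.mod ⊆ C.mod ∧ (∀ y, y ∉ C.mod → s' y = s y) ∧
        (C.NeverInit → C'.NeverInit) ∧ (C.LockFree → C'.LockFree)
  | .abort, .run _ _ _ => False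
  | _, .abort => True

theorem ExecInvariant.trans {c c' c'' : Conf Addr Var V Lk} (h : ExecInvariant c c')
    (h' : ExecInvariant c' c'') : ExecInvariant c c'' := by
  rcases c with ⟨C, s, g⟩ | _ <;> rcases c' with ⟨C', s', g'⟩ | _ <;>
    rcases c'' with ⟨C'', s'', g''⟩ | _ <;> simp only [ExecInvariant] at *
  obtain ⟨a1, a2, a3, a4, a5⟩ := h
  obtain ⟨b1, b2, b3, b4, b5⟩ := h'
  exact ⟨b1.trans a1, b2.trans a2, fun y hy => (b3 y fun h => hy (a2 h)).trans (a3 y hy),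
    b4 ∘ a4, b5 ∘ a5⟩

variable {M : ValueModel Addr V} {stdOut : Addr} {atomic : Cmd Var V Lk → Prop}

theorem Step.execInvariant {c c' : Conf Addr Var V Lk} (h : Step M stdOut atomic c c') :
    ExecInvariant c c' := by
  induction h using Step.rec (motive_2 := fun c c' _ => ExecInvariant c c') with
  | refl c => rcases c with ⟨C, s, g⟩ | _ <;> simp [ExecInvariant]
  | head c c' c'' _ _ h h' => exact h.trans h'
  | next C s s' g g' _ _ h =>
    simp only [ExecInvariant, Cmd.vars, Cmd.mod] at h ⊢
    exact ⟨by simp, by simp, h.2.2.1, by simp, by simp⟩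
  | _ =>
    simp_all [ExecInvariant, Cmd.vars, Cmd.mod, Stack.set_of_ne]
    try grind

theorem Steps.execInvariant {c c' : Conf Addr Var V Lk} (h : Steps M stdOut atomic c c') :
    ExecInvariant c c' := by
  induction h using Steps.rec (motive_1 := fun _ _ _ => True) with
  | refl c => rcases c with ⟨C, s, g⟩ | _ <;> simp [ExecInvariant]
  | head c c' c'' h _ _ h' => exact h.execInvariant.trans h'
  | _ => trivial

/-- The executions of a command do not depend on a variable that it does not mention. -/
def SetInvariant (x : Var) (v : V) (r : Conf Addr Var V Lk → Conf Addr Var V Lk → Prop) :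
    Conf Addr Var V Lk → Conf Addr Var V Lk → Prop
  | .run C s g, .run C' s' g' => x ∉ C.vars → r (.run C (s.set x v) g) (.run C' (s'.set x v) g')
  | _, _ => True

theorem Step.setInvariant (x : Var) (v : V) {c c' : Conf Addr Var V Lk}
    (h : Step M stdOut atomic c c') : SetInvariant x v (Step M stdOut atomic) c c' := by
  induction h using Step.rec
    (motive_2 := fun c c' _ => SetInvariant x v (Steps M stdOut atomic) c c') with
  | refl c =>
    rcases c with ⟨C, s, g⟩ | _
    · exact fun _ => .refl _
    · trivial
  | head c c' c'' h₁ h₂ h h' =>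
    rcases c with ⟨C, s, g⟩ | _ <;> rcases c'' with ⟨C'', s'', g''⟩ | _ <;>
      simp only [SetInvariant]
    rcases c' with ⟨C', s', g'⟩ | _
    · intro hx
      exact .head _ _ _ (h hx) (h' fun hx' => hx (h₁.execInvariant.1 hx'))
    · exact h₂.execInvariant.elim
  | assign y E s g =>
    intro hx
    simp only [Cmd.vars, Set.mem_union, Set.mem_singleton_iff, not_or] at hx
    have := Step.assign (M := M) (stdOut := stdOut) (atomic := atomic) y E (s.set x v) g
    rwa [apply_set_of_notMem_fv hx.2, Stack.set_comm _ _ _ hx.1] at this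
  | read y E s g a w h1 h2 =>
    intro hx
    simp only [Cmd.vars, Set.mem_union, Set.mem_singleton_iff, not_or] at hx
    rw [← Stack.set_comm _ _ _ hx.1]
    exact .read y E _ g a w (by rwa [apply_set_of_notMem_fv hx.2]) h2
  | new y E s g a h1 =>
    intro hx
    simp only [Cmd.vars, Set.mem_union, Set.mem_singleton_iff, not_or] at hx
    rw [← Stack.set_comm _ _ _ hx.1, ← apply_set_of_notMem_fv hx.2 s v]
    exact .new y E _ g a h1
  | write E E' s g a h1 h2 =>
    intro hx
    simp only [Cmd.vars, Set.mem_union, not_or] at hx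
    rw [← apply_set_of_notMem_fv hx.2 s v]
    exact .write E E' _ g a (by rwa [apply_set_of_notMem_fv hx.1]) h2
  | free E s g a h1 h2 =>
    intro hx
    exact .free E _ g a (by rwa [apply_set_of_notMem_fv hx]) h2
  | withLock L E C s g h1 =>
    intro hx
    simp only [Cmd.vars, Set.mem_union, not_or] at hx
    exact .withLock L E C _ g (by rwa [apply_set_of_notMem_fv hx.1])
  | iteTrue E C₁ C₂ s g h1 =>
    intro hx
    simp only [Cmd.vars, Set.mem_union, not_or] at hx
    exact .iteTrue E C₁ C₂ _ g (by rwa [apply_set_of_notMem_fv hx.1.1])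
  | iteFalse E C₁ C₂ s g h1 =>
    intro hx
    simp only [Cmd.vars, Set.mem_union, not_or] at hx
    exact .iteFalse E C₁ C₂ _ g (by rwa [apply_set_of_notMem_fv hx.1.1])
  | loop E C s g => exact fun _ => .loop ..
  | withinS => exact fun _ => .withinS ..
  | seqS => exact fun _ => .seqS ..
  | lockS => exact fun _ => .lockS ..
  | parS => exact fun _ => .parS ..
  | init => exact fun _ => .init ..
  | seq C₁ C₁' C₂ s s' g g' _ ih => exact fun hx => .seq _ _ _ _ _ _ _ (ih fun h => hx (Or.inl h))
  | par1 C₁ C₁' C₂ s s' g g' _ hd ih =>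
    exact fun hx => .par1 _ _ _ _ _ _ _ (ih fun h => hx (Or.inl h)) hd
  | par2 C₁ C₂ C₂' s s' g g' _ hd ih =>
    exact fun hx => .par2 _ _ _ _ _ _ _ (ih fun h => hx (Or.inr h)) hd
  | lock L C C' s s' g g' _ ih => exact fun hx => .lock _ _ _ _ _ _ _ (ih hx)
  | within L C C' s s' g g' _ ih => exact fun hx => .within _ _ _ _ _ _ _ (ih hx)
  | print E s g w h1 =>
    intro hx
    rw [← apply_set_of_notMem_fv hx s v]
    exact .print E _ g w h1
  | next C s s' g g' ha _ ih => exact fun hx => .next _ _ _ _ _ ha (ih hx)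
  | _ => trivial

theorem Step.set {x : Var} (v : V) {C C' : Cmd Var V Lk} {s s' : Stack Var V}
    {g g' : NormHeap Addr V} (h : Step M stdOut atomic (.run C s g) (.run C' s' g'))
    (hx : x ∉ C.vars) : Step M stdOut atomic (.run C (s.set x v) g) (.run C' (s'.set x v) g') :=
  h.setInvariant x v hx

theorem Steps.set {x : Var} (v : V) {C C' : Cmd Var V Lk} {s s' : Stack Var V}
    {g g' : NormHeap Addr V} (h : Steps M stdOut atomic (.run C s g) (.run C' s' g'))
    (hx : x ∉ C.vars) : Steps M stdOut atomic (.run C (s.set x v) g) (.run C' (s'.set x v) g') := by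
  generalize hc : Conf.run C s g = c at h
  generalize hc' : Conf.run C' s' g' = c' at h
  induction h using Steps.rec (motive_1 := fun _ _ _ => True) generalizing C s g with
  | refl c =>
    subst hc
    cases hc'
    exact .refl _
  | head c c₁ c₂ h₁ h₂ _ ih =>
    subst hc hc'
    rcases c₁ with ⟨C₁, s₁, g₁⟩ | _
    · exact .head _ _ _ (h₁.set v hx) (ih (fun h => hx (h₁.execInvariant.1 h)) rfl rfl)
    · exact h₂.execInvariant.elim
  | _ => trivial

end ExecutionInvariants

/-! ### The abstract state in the heap -/

section AbstractState

variable {Addr Var V Lk : Type*}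

theorem bigStar.exists_part {ι : Type*} {P : ι → Assertion Addr Var V} {s : Stack Var V}
    {I : Set ι} {h : Heap Addr V} (hb : bigStar P s I h) :
    ∀ i ∈ I, ∃ h' z, P i s h' ∧ 0 ≤ z ∧ h.raw = h'.raw + z := by
  induction hb with
  | empty h => simp
  | step I j h₁ h₂ h hj hs hP _ ih =>
    rw [isSum_iff] at hs
    intro i hi
    by_cases hij : i = j
    · subst hij
      exact ⟨h₁, h₂.raw, hP, h₂.raw_nonneg, hs⟩
    · obtain ⟨h', z, h1, h2, h3⟩ := ih i ⟨hi, hij⟩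
      exact ⟨h', h₁.raw + z, h1, add_nonneg h₁.raw_nonneg h2, by rw [hs, h3]; abel⟩

theorem Assertion.apt.le_raw {M : ValueModel Addr V} {a : Addr} {p : Perm} {E : Expr Var V}
    {s : Stack Var V} {h : Heap Addr V} (ha : apt M (fun _ => M.addr a) p E s h) :
    (p : ℝ) ≤ h.raw a (E s) := by
  obtain ⟨h₁, h₂, hs, ⟨b, hb, rfl⟩, -⟩ := ha
  obtain rfl := M.addr.injective hb
  rw [isSum_iff.1 hs]
  have := h₂.raw_nonneg a (E s)
  simp only [Pi.zero_apply] at this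
  simp [Heap.raw_single, this]

theorem bigStar_apt {M : ValueModel Addr V} {k : ℕ} {e : Encoding Addr k} {p : Perm}
    {y : Fin k → Expr Var V} {s : Stack Var V} {I : Set (Fin k)} {h : Heap Addr V}
    (hp : ∀ i ∈ I, (p : ℝ) ≤ h.raw (e.loc i) (y i s)) :
    bigStar (fun i => apt M (fun _ => M.addr (e.loc i)) p (y i)) s I h := by
  classical
  induction I, I.toFinite using Set.Finite.induction_on generalizing h with
  | empty => exact .empty h
  | @insert j I hj _ ih =>
    have hle : (Heap.single (e.loc j) p (y j s)).raw ≤ h.raw := by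
      intro b w
      rw [Heap.raw_single]
      have := h.raw_nonneg b w
      split_ifs with hb hw
      · subst hb hw; exact hp j (Or.inl rfl)
      · exact this
      · exact this
    obtain ⟨h₂, hh₂⟩ := Heap.exists_raw_eq (g := h)
      (r := h.raw - (Heap.single (e.loc j) p (y j s)).raw) (sub_nonneg.2 hle)
      (sub_le_self _ (Heap.raw_nonneg _))
    refine .step _ j (Heap.single (e.loc j) p (y j s)) h₂ h (Or.inl rfl) ?_ ?_ ?_
    · rw [isSum_iff, hh₂]; abel
    · exact ⟨_, Heap.empty, isSum_iff.2 (by simp), ⟨_, rfl, rfl⟩, trivial⟩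
    · have hI : insert j I \ {j} = I := by
        ext i; by_cases hij : i = j <;> simp [hij, hj]
      rw [hI]
      refine ih fun i hi => ?_
      have hij : i ≠ j := fun h => hj (h ▸ hi)
      rw [hh₂]
      simpa [Heap.raw_single, e.loc.injective.ne hij] using hp i (Or.inr hi)

/-- The abstract state is owned with permission `p` if every variable is. The distinctness of the
locations makes the separating conjunction the same as the conjunction. -/
theorem absState_iff {M : ValueModel Addr V} {k : ℕ} {e : Encoding Addr k} {p : Perm}
    {y : Fin k → Expr Var V} {s : Stack Var V} {h : Heap Addr V} :
    absState M e p y s h ↔ ∀ i, (p : ℝ) ≤ h.raw (e.loc i) (y i s) := by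
  constructor
  · intro hb i
    obtain ⟨h', z, h1, h2, h3⟩ := bigStar.exists_part hb i (Set.mem_univ i)
    rw [h3]
    have := h2 (e.loc i) (y i s)
    simp only [Pi.zero_apply, Pi.add_apply] at this ⊢
    have := h1.le_raw
    linarith
  · exact fun hp => bigStar_apt fun i _ => hp i

theorem Protects.exists_le_raw {M : ValueModel Addr V} {k : ℕ} {e : Encoding Addr k} {p : Perm}
    {G : Assertion Addr Var V} (hG : Protects M e p G) {s : Stack Var V} {h : Heap Addr V}
    (hh : G s h) : ∃ σ : Fin k → V, ∀ i, (p : ℝ) ≤ h.raw (e.loc i) (σ i) := by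
  have : ∀ i, ∃ v, (p : ℝ) ≤ h.raw (e.loc i) v := by
    intro i
    obtain ⟨h', z, ⟨v, h1⟩, h2, h3⟩ := bigStar.exists_part (hG s h hh) i (Set.mem_univ i)
    refine ⟨v, ?_⟩
    rw [h3]
    have := h2 (e.loc i) v
    simp only [Pi.zero_apply, Pi.add_apply] at this ⊢
    have := h1.le_raw
    linarith
  choose σ hσ using this
  exact ⟨σ, hσ⟩

/-- The heap stores the abstract state `σ`. -/
def Stores {k : ℕ} (e : Encoding Addr k) (g : NormHeap Addr V) (σ : Fin k → V) : Prop :=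
  ∀ i, g.val? (e.loc i) = some (σ i)

theorem Stores.unique {k : ℕ} {e : Encoding Addr k} {g : NormHeap Addr V} {σ τ : Fin k → V}
    (hσ : Stores e g σ) (hτ : Stores e g τ) : σ = τ :=
  funext fun i => Option.some.inj ((hσ i).symm.trans (hτ i))

theorem Stores.of_le_raw {k : ℕ} {e : Encoding Addr k} {g : NormHeap Addr V} {σ : Fin k → V}
    {p : Perm} {x y : Addr → V → ℝ} (hx : ∀ i, (p : ℝ) ≤ x (e.loc i) (σ i)) (hy : 0 ≤ y)
    (hg : g.1.raw = x + y) : Stores e g σ := by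
  intro i
  refine NormHeap.val?_of_raw_pos ?_
  rw [hg]
  have := hx i
  have := p.2.1
  have := hy (e.loc i) (σ i)
  simp only [Pi.zero_apply, Pi.add_apply] at this ⊢
  linarith

/-- The abstract states stored in the two heaps are related by the transition relation. -/
def Simulates {V : Type*} (T : ATS V) (e : Encoding Addr T.k) (g g' : NormHeap Addr V) : Prop :=
  ∃ σ σ', Stores e g σ ∧ Stores e g' σ' ∧ T.next σ σ'

end AbstractState

/-! ### The resources protected by the available locks -/

section Shared

open scoped Classical

variable {Addr Var V Lk : Type*} [Fintype (LockId Lk)]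

/-- The permission function `x` is a sum of heaps that satisfy the assertions `K L`, one for each
lock. -/
def AllInv (K : LockId Lk → Assertion Addr Var V) (s : Stack Var V) (x : Addr → V → ℝ) : Prop :=
  ∃ hs : LockId Lk → Heap Addr V, x = ∑ L, (hs L).raw ∧ ∀ L, K L s (hs L)

/-- The invariants `J`, with those of the locks in `B` replaced by `emp`. -/
noncomputable def mask (J : LockId Lk → Assertion Addr Var V) (B : Set (LockId Lk)) :
    LockId Lk → Assertion Addr Var V :=
  fun L => if L ∈ B then emp else J L

/-- The permission function `x` provides the invariants of exactly the locks outside of `B`. -/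
def Shared (J : LockId Lk → Assertion Addr Var V) (B : Set (LockId Lk)) (s : Stack Var V)
    (x : Addr → V → ℝ) : Prop :=
  AllInv (mask J B) s x

theorem AllInv.nonneg {K : LockId Lk → Assertion Addr Var V} {s : Stack Var V}
    {x : Addr → V → ℝ} (h : AllInv K s x) : 0 ≤ x := by
  obtain ⟨hs, rfl, -⟩ := h
  exact Finset.sum_nonneg fun L _ => (hs L).raw_nonneg

theorem Shared.nonneg {J : LockId Lk → Assertion Addr Var V} {B : Set (LockId Lk)}
    {s : Stack Var V} {x : Addr → V → ℝ} (h : Shared J B s x) : 0 ≤ x :=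
  AllInv.nonneg h

theorem Shared.of_stack_eq {J : LockId Lk → Assertion Addr Var V} {B : Set (LockId Lk)}
    {s s' : Stack Var V} {x : Addr → V → ℝ} (h : Shared J B s x) (hJ : ∀ L, J L s' = J L s) :
    Shared J B s' x := by
  obtain ⟨hs, hx, hK⟩ := h
  refine ⟨hs, hx, fun L => ?_⟩
  have := hK L
  unfold mask at this ⊢
  split_ifs at this ⊢ with hL
  · exact this
  · rwa [hJ L]

/-- The resource of a single lock can be separated from the rest. -/
theorem allInv_iff {K : LockId Lk → Assertion Addr Var V} {s : Stack Var V} {x : Addr → V → ℝ}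
    (L : LockId Lk) :
    AllInv K s x ↔ ∃ h y, K L s h ∧ AllInv (Function.update K L emp) s y ∧ x = h.raw + y := by
  have hsum : ∀ (hs : LockId Lk → Heap Addr V) (h : Heap Addr V),
      (∑ L', (Function.update hs L h L').raw) + (hs L).raw = h.raw + ∑ L', (hs L').raw := by
    intro hs h
    rw [Fintype.sum_eq_add_sum_compl L, Fintype.sum_eq_add_sum_compl L (fun L' => (hs L').raw)]
    rw [Finset.sum_congr rfl (g := fun L' => (hs L').raw)]
    · simp only [Function.update_self]; abel
    · intro L' hL'
      rw [Function.update_of_ne (by simpa using hL')]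
  constructor
  · rintro ⟨hs, rfl, hK⟩
    refine ⟨hs L, _, hK L, ⟨Function.update hs L Heap.empty, rfl, fun L' => ?_⟩, ?_⟩
    · by_cases h : L' = L
      · subst h; simp [emp]
      · simpa [h] using hK L'
    · have := hsum hs Heap.empty
      rw [Heap.raw_empty, zero_add] at this
      rw [← this]; abel
  · rintro ⟨h, y, hL, ⟨hs, rfl, hK⟩, rfl⟩
    refine ⟨Function.update hs L h, ?_, fun L' => ?_⟩
    · have h0 : hs L = Heap.empty := by simpa [emp] using hK L
      have := hsum hs h
      rw [h0, Heap.raw_empty, add_zero] at this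
      exact this.symm
    · by_cases h : L' = L
      · subst h; simpa
      · simpa [h] using hK L'

theorem shared_update_iff {J : LockId Lk → Assertion Addr Var V} {L : LockId Lk}
    (hL : J L = emp) {R : Assertion Addr Var V} {B : Set (LockId Lk)} {s : Stack Var V}
    {x : Addr → V → ℝ} :
    Shared (Function.update J L R) B s x ↔
      ∃ h y, (if L ∈ B then emp else R) s h ∧ Shared J B s y ∧ x = h.raw + y := by
  have h1 : mask (Function.update J L R) B L = if L ∈ B then emp else R := by simp [mask]
  have h2 : Function.update (mask (Function.update J L R) B) L emp = mask J B := by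
    funext L'
    by_cases h : L' = L
    · subst h; simp [mask, hL]
    · simp [mask, h]
  rw [Shared, allInv_iff L, h1, h2]
  rfl

theorem Shared.of_mask_eq {J J' : LockId Lk → Assertion Addr Var V} {B B' : Set (LockId Lk)}
    {s : Stack Var V} {x : Addr → V → ℝ} (h : Shared J B s x)
    (hJ : ∀ L, mask J B L = mask J' B' L) : Shared J' B' s x := by
  rwa [Shared, ← funext hJ]

/-- Locks without an invariant may be acquired and released at will. -/
theorem Shared.of_emp {J : LockId Lk → Assertion Addr Var V} {B B' : Set (LockId Lk)}
    {s : Stack Var V} {x : Addr → V → ℝ} (h : Shared J B s x)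
    (hB : ∀ L, J L = emp ∨ (L ∈ B ↔ L ∈ B')) : Shared J B' s x := by
  refine h.of_mask_eq fun L => ?_
  rcases hB L with h | h <;> simp [mask, h]

theorem Shared.exists_mem {J : LockId Lk → Assertion Addr Var V} {B : Set (LockId Lk)}
    {s : Stack Var V} {x : Addr → V → ℝ} (h : Shared J B s x) {L : LockId Lk} (hL : L ∉ B) :
    ∃ h y, J L s h ∧ 0 ≤ y ∧ x = h.raw + y := by
  obtain ⟨h, y, h1, h2, h3⟩ := (allInv_iff L).1 h
  exact ⟨h, y, by simpa [mask, hL] using h1, h2.nonneg, h3⟩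

/-- Precise invariants determine the shared part of a heap. -/
theorem Shared.unique {J : LockId Lk → Assertion Addr Var V} (hJ : ∀ L, Precise (J L))
    {B : Set (LockId Lk)} {s : Stack Var V} {g : Heap Addr V} {x₁ x₂ y₁ y₂ : Addr → V → ℝ}
    (h₁ : Shared J B s x₁) (h₂ : Shared J B s x₂) (hy₁ : 0 ≤ y₁) (hy₂ : 0 ≤ y₂)
    (hg₁ : g.raw = x₁ + y₁) (hg₂ : g.raw = x₂ + y₂) : x₁ = x₂ := by
  have hpart : ∀ {x y : Addr → V → ℝ} {hs : LockId Lk → Heap Addr V}, 0 ≤ y → g.raw = x + y →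
      x = ∑ L, (hs L).raw → ∀ L, ∃ h, IsSum (hs L) h g := by
    intro x y hs hy hg hx L
    have hle : (hs L).raw ≤ g.raw := by
      have h1 : (hs L).raw ≤ x := by
        rw [hx]
        exact Finset.single_le_sum (f := fun L => (hs L).raw) (fun L _ => (hs L).raw_nonneg)
          (Finset.mem_univ L)
      rw [hg]
      exact h1.trans (le_add_of_nonneg_right hy)
    obtain ⟨h, hh⟩ := Heap.exists_raw_eq (g := g) (r := g.raw - (hs L).raw) (sub_nonneg.2 hle)
      (sub_le_self _ (Heap.raw_nonneg _))
    exact ⟨h, isSum_iff.2 (by rw [hh]; abel)⟩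
  obtain ⟨hs₁, hx₁, hK₁⟩ := h₁
  obtain ⟨hs₂, hx₂, hK₂⟩ := h₂
  rw [hx₁, hx₂]
  refine Finset.sum_congr rfl fun L _ => congrArg _ ?_
  obtain ⟨h₁, hh₁⟩ := hpart hy₁ hg₁ hx₁ L
  obtain ⟨h₂, hh₂⟩ := hpart hy₂ hg₂ hx₂ L
  have e1 := hK₁ L
  have e2 := hK₂ L
  unfold mask at e1 e2
  split_ifs at e1 e2 with hL
  · exact e1.trans e2.symm
  · exact hJ L s _ _ _ _ g hh₁ hh₂ e1 e2

theorem Shared.of_bigStar {J : LockId Lk → Assertion Addr Var V} {s : Stack Var V}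
    {I : Set (LockId Lk)} {h : Heap Addr V} (hb : bigStar J s I h) :
    ∃ x y, Shared J Iᶜ s x ∧ 0 ≤ y ∧ h.raw = x + y := by
  induction hb with
  | empty h =>
    refine ⟨0, h.raw, ⟨fun _ => Heap.empty, by simp, ?_⟩, h.raw_nonneg, by simp⟩
    intro L
    simp [mask, emp]
  | step I j h₁ h₂ h hj hs hP _ ih =>
    obtain ⟨x, y, hx, hy, hxy⟩ := ih
    refine ⟨h₁.raw + x, y, (allInv_iff j).2 ⟨h₁, x, by simpa [mask, hj] using hP, ?_, rfl⟩, hy, ?_⟩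
    · have : Function.update (mask J Iᶜ) j emp = mask J (I \ {j})ᶜ := by
        funext L
        by_cases hL : L = j
        · subst hL; simp [mask]
        · simp [mask, hL]
      rw [this]
      exact hx
    · rw [isSum_iff.1 hs, hxy]; abel

end Shared

/-! ### Safe configurations -/

section Safe

open scoped Classical

variable {Addr Var V Lk : Type*}

/-- The refinement obligations for a step from `C` to `C'`. The step simulates a transition if the
ghost lock has an invariant that protects the abstract state, or if the command declares the ghost
lock itself. An `Init` block starts in an initial state. -/
structure Refines (M : ValueModel Addr V) (T : ATS V) (e : Encoding Addr T.k)
    (J : LockId Lk → Assertion Addr Var V) (C : Cmd Var V Lk) (g : NormHeap Addr V)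
    (C' : Cmd Var V Lk) (g' : NormHeap Addr V) : Prop where
  simulates_of_protects : (∃ p, Protects M e p (J .ghost)) → Simulates T e g g'
  simulates_of_lock : ∀ D D', C = .lock .ghost D → C' = .lock .ghost D' → Simulates T e g g'
  init : ∀ D, C = .init D → ∃ σ, Stores e g' σ ∧ T.init σ

variable {M : ValueModel Addr V} {T : ATS V} {e : Encoding Addr T.k}
  {atomic : Cmd Var V Lk → Prop} {J : LockId Lk → Assertion Addr Var V}

theorem Refines.congr {J' : LockId Lk → Assertion Addr Var V} {C₁ C₁' C C' : Cmd Var V Lk}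
    {g g' : NormHeap Addr V} (h : Refines M T e J' C₁ g C₁' g') (hJ : J .ghost = J' .ghost)
    (hlock : ∀ D D', C = .lock .ghost D → C' ≠ .lock .ghost D') (hinit : ∀ D, C ≠ .init D) :
    Refines M T e J C g C' g' where
  simulates_of_protects := by rw [hJ]; exact h.1
  simulates_of_lock := fun D D' h h' => absurd h' (hlock D D' h)
  init := fun D h => absurd h (hinit D)

theorem Protects.not_emp {p : Perm} : ¬ Protects M e p (emp : Assertion Addr Var V) := by
  intro h
  obtain ⟨σ, hσ⟩ := h.exists_le_raw (s := fun _ => M.seq []) (h := Heap.empty) rfl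
  have := hσ T.fst
  rw [Heap.raw_empty] at this
  exact absurd p.2.1 (not_lt.2 this)

theorem Step.not_skip {stdOut : Addr} {C' : Cmd Var V Lk} {s s' : Stack Var V}
    {g g' : NormHeap Addr V} : ¬ Step M stdOut atomic (.run .skip s g) (.run C' s' g') := by
  rintro ⟨⟩

/-- `Safe M T e atomic J Q n C s h`: for `n` steps, executions of `C` from the stack `s` and the
local heap `h` maintain the decomposition of the global heap into the local heap, the resources of
the locks with invariants `J` that nobody holds, and an untouched frame `f`; they fulfil the
refinement obligations, and satisfy `Q` locally on termination. The set `A` stands for the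
locks that are held by other threads. The ghost lock is never held. Aborting executions are not
excluded, because an aborted configuration is not observable. -/
def Safe [Fintype (LockId Lk)] (M : ValueModel Addr V) (T : ATS V) (e : Encoding Addr T.k)
    (atomic : Cmd Var V Lk → Prop) (J : LockId Lk → Assertion Addr Var V)
    (Q : Assertion Addr Var V) : ℕ → Cmd Var V Lk → Stack Var V → Heap Addr V → Prop
  | 0, _, _, _ => True
  | n + 1, C, s, h => (C = .skip → Q s h) ∧ .ghost ∉ C.locked ∧
      ∀ A f x g C' s' g', .ghost ∉ A → Disjoint A C.locked → Disjoint A C'.locked → 0 ≤ f →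
        Shared J (A ∪ C.locked) s x → g.1.raw = h.raw + x + f →
        Step M e.stdOut atomic (.run C s g) (.run C' s' g') →
        Refines M T e J C g C' g' ∧
        ∃ h' x', Shared J (A ∪ C'.locked) s' x' ∧ g'.1.raw = h'.raw + x' + f ∧
          Safe M T e atomic J Q n C' s' h'

variable [Fintype (LockId Lk)] {P Q R : Assertion Addr Var V}

theorem Safe.pred {n : ℕ} {C : Cmd Var V Lk} {s : Stack Var V} {h : Heap Addr V}
    (hs : Safe M T e atomic J Q (n + 1) C s h) : Safe M T e atomic J Q n C s h := by
  induction n generalizing C s h with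
  | zero => trivial
  | succ n ih =>
    obtain ⟨h1, h2, h3⟩ := hs
    refine ⟨h1, h2, fun A f x g C' s' g' a1 a2 a3 a4 a5 a6 a7 => ?_⟩
    obtain ⟨b1, h', x', b2, b3, b4⟩ := h3 A f x g C' s' g' a1 a2 a3 a4 a5 a6 a7
    exact ⟨b1, h', x', b2, b3, ih b4⟩

/-- A step that does not touch the resources of the locks does not change the abstract state:
the invariant of the ghost lock, which owns a permission for it, is among these resources. -/
theorem Refines.of_shared_eq (hT : T.StutterInvariant) {B : Set (LockId Lk)} {s : Stack Var V}
    {x y y' : Addr → V → ℝ} {C C' : Cmd Var V Lk} {g g' : NormHeap Addr V}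
    (hx : Shared J B s x) (hB : .ghost ∉ B) (hy : 0 ≤ y) (hy' : 0 ≤ y')
    (hg : g.1.raw = x + y) (hg' : g'.1.raw = x + y')
    (hlock : ∀ D D', C = .lock .ghost D → C' ≠ .lock .ghost D') (hinit : ∀ D, C ≠ .init D) :
    Refines M T e J C g C' g' where
  simulates_of_protects := by
    rintro ⟨p, hp⟩
    obtain ⟨h, z, hh, hz, rfl⟩ := hx.exists_mem hB
    obtain ⟨σ, hσ⟩ := hp.exists_le_raw hh
    exact ⟨σ, σ, .of_le_raw hσ (add_nonneg hz hy) (by rw [hg, add_assoc]),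
      .of_le_raw hσ (add_nonneg hz hy') (by rw [hg', add_assoc]), hT σ⟩
  simulates_of_lock := fun D D' h h' => absurd h' (hlock D D' h)
  init := fun D h => absurd h (hinit D)

/-! ### Soundness of the rules -/

theorem Safe.skip {s : Stack Var V} {h : Heap Addr V} (hQ : Q s h) (n : ℕ) :
    Safe M T e atomic J Q n .skip s h := by
  cases n with
  | zero => trivial
  | succ n => exact ⟨fun _ => hQ, by simp, fun _ _ _ _ _ _ _ _ _ _ _ _ _ h => (Step.not_skip h).elim⟩

/-- Safety of commands that do not use the resources of the locks in their first step. -/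
theorem Safe.of_local_step (hT : T.StutterInvariant) {n : ℕ} {C : Cmd Var V Lk}
    {s : Stack Var V} {h : Heap Addr V} (hskip : C ≠ .skip) (hC : C.locked = ∅)
    (hlock : ∀ L D, C ≠ .lock L D) (hinit : ∀ D, C ≠ .init D)
    (hstep : ∀ g z C' s' g', 0 ≤ z → g.1.raw = h.raw + z →
      Step M e.stdOut atomic (.run C s g) (.run C' s' g') →
      C'.locked = ∅ ∧ (∀ L, J L s' = J L s) ∧ ∃ h', g'.1.raw = h'.raw + z ∧
        Safe M T e atomic J Q n C' s' h') :
    Safe M T e atomic J Q (n + 1) C s h := by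
  refine ⟨fun h => absurd h hskip, by simp [hC], ?_⟩
  intro A f x g C' s' g' hA _ _ hf hx hg hst
  rw [hC, Set.union_empty] at hx
  have hx0 := hx.nonneg
  obtain ⟨h1, h2, h', h3, h4⟩ := hstep g (x + f) C' s' g' (add_nonneg hx0 hf)
    (by rw [hg]; abel) hst
  refine ⟨?_, h', x, ?_, by rw [h3]; abel, h4⟩
  · exact .of_shared_eq hT hx hA (add_nonneg h.raw_nonneg hf) (add_nonneg h'.raw_nonneg hf)
      (by rw [hg]; abel) (by rw [h3]; abel) (fun D _ h => absurd h (hlock _ D)) hinit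
  · rw [h1, Set.union_empty]
    exact hx.of_stack_eq h2

theorem Safe.assign (hT : T.StutterInvariant) {x : Var} {E : Expr Var V}
    (hx : ∀ L, x ∉ fv (J L)) {s : Stack Var V} {h : Heap Addr V} (hP : subst P x E s h) (n : ℕ) :
    Safe M T e atomic J P n (.assign x E) s h := by
  cases n with
  | zero => trivial
  | succ n =>
    refine Safe.of_local_step hT (by simp) (by simp) (by simp) (by simp) ?_
    intro g z C' s' g' _ hg hst
    cases hst
    exact ⟨by simp, fun L => apply_set_of_notMem_fv (hx L) _ _, h, hg,
      Safe.skip (Q := P) (s := s.set x (E s)) hP n⟩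

theorem Safe.write (hT : T.StutterInvariant) {E E' : Expr Var V} {s : Stack Var V}
    {h : Heap Addr V} (hP : alloc M E Perm.full s h) (n : ℕ) :
    Safe M T e atomic J (pt M E Perm.full E') n (.write E E') s h := by
  cases n with
  | zero => trivial
  | succ n =>
    refine Safe.of_local_step hT (by simp) (by simp) (by simp) (by simp) ?_
    intro g z C' s' g' hz hg hst
    obtain ⟨v, a, ha, rfl⟩ := hP
    cases hst with
    | write _ _ _ _ b hb _ =>
      obtain rfl := M.addr.injective (ha.symm.trans hb)
      exact ⟨by simp, fun _ => rfl, Heap.single a Perm.full (E' s),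
        NormHeap.raw_write hz hg _, Safe.skip ⟨a, ha, rfl⟩ n⟩

theorem Safe.read (hT : T.StutterInvariant) {x : Var} {E E' : Expr Var V} {p : Perm}
    (hxE : x ∉ fv E) (hxE' : x ∉ fv E') (hx : ∀ L, x ∉ fv (J L)) {s : Stack Var V}
    {h : Heap Addr V} (hP : pt M E p E' s h) (n : ℕ) :
    Safe M T e atomic J (and (pt M E p E') (varEq x E')) n (.read x E) s h := by
  cases n with
  | zero => trivial
  | succ n =>
    refine Safe.of_local_step hT (by simp) (by simp) (by simp) (by simp) ?_
    intro g z C' s' g' hz hg hst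
    obtain ⟨a, ha, rfl⟩ := hP
    cases hst with
    | read _ _ _ _ b v hb hv =>
      obtain rfl := M.addr.injective (ha.symm.trans hb)
      have hpos : 0 < g.1.raw a (E' s) := by
        rw [hg]
        have h1 := hz a (E' s)
        have h2 := p.2.1
        simp only [Pi.zero_apply] at h1
        simp only [Pi.add_apply, Heap.raw_single, if_true]
        linarith
      have hvE : v = E' s := Option.some.inj (hv.symm.trans (NormHeap.val?_of_raw_pos hpos))
      refine ⟨by simp, fun L => apply_set_of_notMem_fv (hx L) _ _, _, hg, Safe.skip ⟨?_, ?_⟩ n⟩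
      · exact ⟨a, by rwa [apply_set_of_notMem_fv hxE], by rw [apply_set_of_notMem_fv hxE']⟩
      · rw [varEq, apply_set_of_notMem_fv hxE', Stack.set_self, hvE]

theorem Safe.new (hT : T.StutterInvariant) {x : Var} {E : Expr Var V} (hxE : x ∉ fv E)
    (hx : ∀ L, x ∉ fv (J L)) {s : Stack Var V} {h : Heap Addr V} (hP : emp s h) (n : ℕ) :
    Safe M T e atomic J (pt M (fun s => s x) Perm.full E) n (.new x E) s h := by
  cases n with
  | zero => trivial
  | succ n =>
    refine Safe.of_local_step hT (by simp) (by simp) (by simp) (by simp) ?_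
    intro g z C' s' g' hz hg hst
    obtain rfl : h = Heap.empty := hP
    rw [Heap.raw_empty, zero_add] at hg
    cases hst with
    | new _ _ _ _ a ha =>
      refine ⟨by simp, fun L => apply_set_of_notMem_fv (hx L) _ _,
        Heap.single a Perm.full (E s), ?_, Safe.skip ⟨a, Stack.set_self _ _ _, ?_⟩ n⟩
      · rw [NormHeap.raw_new ha, hg]
      · rw [apply_set_of_notMem_fv hxE]

theorem Safe.free (hT : T.StutterInvariant) {E : Expr Var V} {s : Stack Var V}
    {h : Heap Addr V} (hP : alloc M E Perm.full s h) (n : ℕ) :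
    Safe M T e atomic J emp n (.free E) s h := by
  cases n with
  | zero => trivial
  | succ n =>
    refine Safe.of_local_step hT (by simp) (by simp) (by simp) (by simp) ?_
    intro g z C' s' g' hz hg hst
    obtain ⟨v, a, ha, rfl⟩ := hP
    cases hst with
    | free _ _ _ b hb _ =>
      obtain rfl := M.addr.injective (ha.symm.trans hb)
      exact ⟨by simp, fun _ => rfl, Heap.empty,
        by rw [NormHeap.raw_free hz hg, Heap.raw_empty, zero_add], Safe.skip rfl n⟩

theorem Safe.print (hT : T.StutterInvariant) {E E' : Expr Var V} {s : Stack Var V}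
    {h : Heap Addr V} (hP : pt M (fun _ => M.addr e.stdOut) Perm.full E' s h) (n : ℕ) :
    Safe M T e atomic J
      (pt M (fun _ => M.addr e.stdOut) Perm.full (fun s => M.append (E s) (E' s))) n
      (.print E) s h := by
  cases n with
  | zero => trivial
  | succ n =>
    refine Safe.of_local_step hT (by simp) (by simp) (by simp) (by simp) ?_
    intro g z C' s' g' hz hg hst
    obtain ⟨a, ha, rfl⟩ := hP
    obtain rfl := M.addr.injective ha
    cases hst with
    | print _ _ _ v hv =>
      have hpos : 0 < g.1.raw e.stdOut (E' s) := by
        rw [hg]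
        have h1 := hz e.stdOut (E' s)
        simp only [Pi.zero_apply] at h1
        simp only [Pi.add_apply, Heap.raw_single, if_true, Perm.full]
        linarith
      have hvE : v = E' s := Option.some.inj (hv.symm.trans (NormHeap.val?_of_raw_pos hpos))
      subst hvE
      exact ⟨by simp, fun _ => rfl, Heap.single e.stdOut Perm.full (M.append (E s) (E' s)),
        NormHeap.raw_write hz hg _, Safe.skip ⟨_, rfl, rfl⟩ n⟩

theorem Safe.seq (hT : T.StutterInvariant) {C₂ : Cmd Var V Lk} (hC₂ : C₂.locked = ∅)
    {n : ℕ} (H₂ : ∀ m < n, ∀ s h, R s h → Safe M T e atomic J Q m C₂ s h) {C₁ : Cmd Var V Lk}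
    {s : Stack Var V} {h : Heap Addr V} (H₁ : Safe M T e atomic J R n C₁ s h) :
    Safe M T e atomic J Q n (.seq C₁ C₂) s h := by
  induction n generalizing C₁ s h with
  | zero => trivial
  | succ n ih =>
    obtain ⟨h1, h2, h3⟩ := H₁
    refine ⟨by simp, by simp [hC₂, h2], ?_⟩
    intro A f x g C' s' g' hA hd hd' hf hx hg hst
    simp only [Cmd.locked_seq, hC₂, Set.union_empty] at hd hx
    cases hst with
    | seqS =>
      simp only [Cmd.locked_skip, Set.union_empty] at hx
      refine ⟨?_, h, x, by simpa [hC₂] using hx, hg, H₂ n n.lt_succ_self s h (h1 rfl)⟩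
      exact .of_shared_eq hT hx hA (add_nonneg h.raw_nonneg hf) (add_nonneg h.raw_nonneg hf)
        (by rw [hg]; abel) (by rw [hg]; abel) (by simp) (by simp)
    | seq _ C₁' _ _ _ _ _ hst =>
      simp only [Cmd.locked_seq, hC₂, Set.union_empty] at hd' ⊢
      obtain ⟨b1, h', x', b2, b3, b4⟩ := h3 A f x g C₁' s' g' hA hd hd' hf hx hg hst
      exact ⟨b1.congr rfl (by simp) (by simp), h', x', b2, b3,
        ih (fun m hm => H₂ m (hm.trans n.lt_succ_self)) b4⟩

theorem Safe.ite (hT : T.StutterInvariant) {E : Expr Var V} {C₁ C₂ : Cmd Var V Lk}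
    (hC₁ : C₁.locked = ∅) (hC₂ : C₂.locked = ∅) {n : ℕ} {s : Stack Var V} {h : Heap Addr V}
    (H₁ : E s = M.bool true → Safe M T e atomic J Q n C₁ s h)
    (H₂ : E s ≠ M.bool true → Safe M T e atomic J Q n C₂ s h) :
    Safe M T e atomic J Q (n + 1) (.ite E C₁ C₂) s h := by
  refine Safe.of_local_step hT (by simp) (by simp [hC₁, hC₂]) (by simp) (by simp) ?_
  intro g z C' s' g' hz hg hst
  cases hst with
  | iteTrue _ _ _ _ _ hE => exact ⟨hC₁, fun _ => rfl, h, hg, H₁ hE⟩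
  | iteFalse _ _ _ _ _ hE =>
    exact ⟨hC₂, fun _ => rfl, h, hg, H₂ (by rw [hE]; exact M.bool.injective.ne (by simp))⟩

theorem Safe.loop (hT : T.StutterInvariant) {E : Expr Var V} {C : Cmd Var V Lk}
    (hC : C.locked = ∅)
    (H : ∀ n s h, and P (expr M E) s h → Safe M T e atomic J P n C s h) (n : ℕ) :
    ∀ s h, P s h → Safe M T e atomic J (and P (not (expr M E))) n (.loop E C) s h := by
  -- The iterations that follow may be assumed safe for any smaller number of steps.
  induction n using Nat.strong_induction_on with
  | _ n ih =>
  intro s h hP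
  rcases n with _ | n
  · trivial
  refine Safe.of_local_step hT (by simp) (by simp [hC]) (by simp) (by simp) ?_
  intro g z C' s' g' hz hg hst
  cases hst
  refine ⟨by simp [hC], fun _ => rfl, h, hg, ?_⟩
  rcases n with _ | n
  · trivial
  refine Safe.ite hT (by simp [hC]) (by simp) (fun hE => ?_) fun hE => Safe.skip ⟨hP, hE⟩ n
  exact Safe.seq hT (by simp [hC]) (fun m hm s h hP => ih m (by omega) s h hP) (H n s h ⟨hP, hE⟩)

end Safe

section Rules

open scoped Classical

variable {Addr Var V Lk : Type*} [Fintype (LockId Lk)] {M : ValueModel Addr V} {T : ATS V}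
  {e : Encoding Addr T.k} {atomic : Cmd Var V Lk → Prop} {J : LockId Lk → Assertion Addr Var V}
  {P Q R : Assertion Addr Var V}

theorem Safe.cons (hQ : Entails Q R) {n : ℕ} {C : Cmd Var V Lk} {s : Stack Var V}
    {h : Heap Addr V} (hs : Safe M T e atomic J Q n C s h) : Safe M T e atomic J R n C s h := by
  induction n generalizing C s h with
  | zero => trivial
  | succ n ih =>
    obtain ⟨h1, h2, h3⟩ := hs
    refine ⟨fun hC => hQ _ _ (h1 hC), h2, fun A f x g C' s' g' a1 a2 a3 a4 a5 a6 a7 => ?_⟩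
    obtain ⟨b1, h', x', b2, b3, b4⟩ := h3 A f x g C' s' g' a1 a2 a3 a4 a5 a6 a7
    exact ⟨b1, h', x', b2, b3, ih b4⟩

theorem Safe.ex {y : Var} {v : V} (hJ : ∀ L, y ∉ fv (J L)) {n : ℕ} {C : Cmd Var V Lk}
    (hC : y ∉ C.vars) {s : Stack Var V} {h : Heap Addr V}
    (hs : Safe M T e atomic J Q n C (s.set y v) h) : Safe M T e atomic J (ex y Q) n C s h := by
  induction n generalizing C s h with
  | zero => trivial
  | succ n ih =>
    obtain ⟨h1, h2, h3⟩ := hs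
    refine ⟨fun hC => ⟨v, h1 hC⟩, h2, fun A f x g C' s' g' a1 a2 a3 a4 a5 a6 a7 => ?_⟩
    obtain ⟨b1, h', x', b2, b3, b4⟩ := h3 A f x g C' (s'.set y v) g' a1 a2 a3 a4
      (a5.of_stack_eq fun L => apply_set_of_notMem_fv (hJ L) _ _) a6 (a7.set v hC)
    exact ⟨b1, h', x', b2.of_stack_eq fun L => (apply_set_of_notMem_fv (hJ L) _ _).symm, b3,
      ih (fun h => hC (a7.execInvariant.1 h)) b4⟩

theorem Safe.set {y : Var} (v : V) (hJ : ∀ L, y ∉ fv (J L)) {n : ℕ} {C : Cmd Var V Lk}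
    (hC : y ∉ C.vars) (hQ : y ∉ fv Q) {s : Stack Var V} {h : Heap Addr V}
    (hs : Safe M T e atomic J Q n C s h) : Safe M T e atomic J Q n C (s.set y v) h := by
  refine (Safe.ex (Q := Q) (v := s y) hJ hC ?_).cons ?_
  · rwa [Stack.set_set, Stack.set_eq_self]
  · rintro t h' ⟨w, hw⟩
    rwa [apply_set_of_notMem_fv hQ] at hw

theorem Safe.of_agree {F : Set Var} (hF : F.Finite) (hJ : ∀ x ∈ F, ∀ L, x ∉ fv (J L)) {n : ℕ}
    {C : Cmd Var V Lk} (hC : ∀ x ∈ F, x ∉ C.vars) (hQ : ∀ x ∈ F, x ∉ fv Q) {s s' : Stack Var V}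
    (hss : ∀ y, y ∉ F → s' y = s y) {h : Heap Addr V} (hs : Safe M T e atomic J Q n C s h) :
    Safe M T e atomic J Q n C s' h :=
  Stack.transfer hF (p := fun t => Safe M T e atomic J Q n C t h)
    (fun _ x v hx => Safe.set v (hJ x hx) (hC x hx) (hQ x hx)) hss hs

theorem Safe.frame {n : ℕ} {C : Cmd Var V Lk} (hR : ∀ x ∈ C.mod, x ∉ fv R) {s : Stack Var V}
    {h h₁ h₂ : Heap Addr V} (hh : h.raw = h₁.raw + h₂.raw) (hs₂ : R s h₂)
    (hs : Safe M T e atomic J Q n C s h₁) : Safe M T e atomic J (star Q R) n C s h := by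
  induction n generalizing C s h h₁ with
  | zero => trivial
  | succ n ih =>
    obtain ⟨h1, h2, h3⟩ := hs
    refine ⟨fun hC => ⟨h₁, h₂, isSum_iff.2 hh, h1 hC, hs₂⟩, h2,
      fun A f x g C' s' g' a1 a2 a3 a4 a5 a6 a7 => ?_⟩
    obtain ⟨b1, h', x', b2, b3, b4⟩ := h3 A (h₂.raw + f) x g C' s' g' a1 a2 a3
      (add_nonneg h₂.raw_nonneg a4) a5 (by rw [a6, hh]; abel) a7
    obtain ⟨-, hmod, hagree, -⟩ := a7.execInvariant
    obtain ⟨k, hk⟩ := Heap.exists_raw_add (g := g'.1) (h₁ := h') (h₂ := h₂) (z := x' + f)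
      (add_nonneg b2.nonneg a4) (by rw [b3]; abel)
    refine ⟨b1, k, x', b2, by rw [b3, hk]; abel, ih (fun x hx => hR x (hmod hx)) hk ?_ b4⟩
    rwa [apply_eq_of_agree C.mod_finite hR hagree]

theorem Safe.conj {Q₁ Q₂ : Assertion Addr Var V} (hJ : ∀ L, Precise (J L)) {n : ℕ}
    {C : Cmd Var V Lk} {s : Stack Var V} {h : Heap Addr V}
    (hs₁ : Safe M T e atomic J Q₁ n C s h) (hs₂ : Safe M T e atomic J Q₂ n C s h) :
    Safe M T e atomic J (and Q₁ Q₂) n C s h := by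
  induction n generalizing C s h with
  | zero => trivial
  | succ n ih =>
    obtain ⟨h1, h2, h3⟩ := hs₁
    obtain ⟨h1', -, h3'⟩ := hs₂
    refine ⟨fun hC => ⟨h1 hC, h1' hC⟩, h2, fun A f x g C' s' g' a1 a2 a3 a4 a5 a6 a7 => ?_⟩
    obtain ⟨b1, k, x₁, b2, b3, b4⟩ := h3 A f x g C' s' g' a1 a2 a3 a4 a5 a6 a7
    obtain ⟨-, k', x₂, b2', b3', b4'⟩ := h3' A f x g C' s' g' a1 a2 a3 a4 a5 a6 a7
    obtain rfl : x₁ = x₂ := Shared.unique hJ b2 b2' (add_nonneg k.raw_nonneg a4)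
      (add_nonneg k'.raw_nonneg a4) (g := g'.1) (by rw [b3]; abel) (by rw [b3']; abel)
    obtain rfl : k = k' := Heap.raw_injective (add_right_cancel (add_right_cancel
      (b3.symm.trans b3')))
    exact ⟨b1, k, x₁, b2, b3, ih b4 b4'⟩

theorem Safe.par (hT : T.StutterInvariant) {Q₁ Q₂ : Assertion Addr Var V} {n : ℕ}
    {C₁ C₂ : Cmd Var V Lk} (hd : Disjoint C₁.locked C₂.locked)
    (hm₁ : ∀ x ∈ C₁.mod, x ∉ C₂.vars ∧ x ∉ fv Q₂ ∧ ∀ L, x ∉ fv (J L))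
    (hm₂ : ∀ x ∈ C₂.mod, x ∉ C₁.vars ∧ x ∉ fv Q₁ ∧ ∀ L, x ∉ fv (J L))
    {s : Stack Var V} {h h₁ h₂ : Heap Addr V} (hh : h.raw = h₁.raw + h₂.raw)
    (hs₁ : Safe M T e atomic J Q₁ n C₁ s h₁) (hs₂ : Safe M T e atomic J Q₂ n C₂ s h₂) :
    Safe M T e atomic J (star Q₁ Q₂) n (.par C₁ C₂) s h := by
  induction n generalizing C₁ C₂ s h h₁ h₂ with
  | zero => trivial
  | succ n ih =>
    obtain ⟨h1, h2, h3⟩ := id hs₁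
    obtain ⟨h1', h2', h3'⟩ := id hs₂
    refine ⟨by simp, by simp [h2, h2'], fun A f x g C' s' g' hA a2 a3 hf hx hg hst => ?_⟩
    simp only [Cmd.locked_par, Set.disjoint_union_right] at a2 hx
    cases hst with
    | parS =>
      refine ⟨?_, h, x, by simpa using hx, hg,
        Safe.skip ⟨h₁, h₂, isSum_iff.2 hh, h1 rfl, h1' rfl⟩ n⟩
      exact .of_shared_eq hT hx (by simp [hA]) (add_nonneg h.raw_nonneg hf)
        (add_nonneg h.raw_nonneg hf) (by rw [hg]; abel) (by rw [hg]; abel) (by simp) (by simp)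
    | par1 _ C₁' _ _ _ _ _ hst hdisj =>
      -- The locks held by the other thread join those held by the environment.
      have hdisj := Set.disjoint_iff_inter_eq_empty.2 hdisj
      simp only [Cmd.locked_par, Set.disjoint_union_right] at a3
      obtain ⟨b1, k, x', b2, b3, b4⟩ := h3 (A ∪ C₂.locked) (h₂.raw + f) x g C₁' s' g'
        (by simp [hA, h2']) (Set.disjoint_union_left.2 ⟨a2.1, hd.symm⟩)
        (Set.disjoint_union_left.2 ⟨a3.1, hdisj.symm⟩) (add_nonneg h₂.raw_nonneg hf)
        (by rwa [Set.union_assoc, Set.union_comm C₂.locked]) (by rw [hg, hh]; abel) hst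
      obtain ⟨hvars, hmod, hagree, -⟩ := hst.execInvariant
      obtain ⟨k', hk'⟩ := Heap.exists_raw_add (g := g'.1) (h₁ := k) (h₂ := h₂) (z := x' + f)
        (add_nonneg b2.nonneg hf) (by rw [b3]; abel)
      refine ⟨b1.congr rfl (by simp) (by simp), k', x', ?_, by rw [b3, hk']; abel,
        ih hdisj (fun x hx => hm₁ x (hmod hx))
          (fun x hx => ⟨fun h => (hm₂ x hx).1 (hvars h), (hm₂ x hx).2⟩) hk' b4 ?_⟩
      · rwa [Set.union_assoc, Set.union_comm C₂.locked, ← Cmd.locked_par] at b2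
      · exact hs₂.pred.of_agree C₁.mod_finite (fun x hx => (hm₁ x hx).2.2)
          (fun x hx => (hm₁ x hx).1) (fun x hx => (hm₁ x hx).2.1) hagree
    | par2 _ _ C₂' _ _ _ _ hst hdisj =>
      have hdisj := Set.disjoint_iff_inter_eq_empty.2 hdisj
      simp only [Cmd.locked_par, Set.disjoint_union_right] at a3
      obtain ⟨b1, k, x', b2, b3, b4⟩ := h3' (A ∪ C₁.locked) (h₁.raw + f) x g C₂' s' g'
        (by simp [hA, h2]) (Set.disjoint_union_left.2 ⟨a2.2, hd⟩)
        (Set.disjoint_union_left.2 ⟨a3.2, hdisj⟩) (add_nonneg h₁.raw_nonneg hf)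
        (by rwa [Set.union_assoc]) (by rw [hg, hh]; abel) hst
      obtain ⟨hvars, hmod, hagree, -⟩ := hst.execInvariant
      obtain ⟨k', hk'⟩ := Heap.exists_raw_add (g := g'.1) (h₁ := h₁) (h₂ := k) (z := x' + f)
        (add_nonneg b2.nonneg hf) (by rw [b3]; abel)
      refine ⟨b1.congr rfl (by simp) (by simp), k', x', ?_, by rw [b3, hk']; abel,
        ih hdisj (fun x hx => ⟨fun h => (hm₁ x hx).1 (hvars h), (hm₁ x hx).2⟩)
          (fun x hx => hm₂ x (hmod hx)) hk' ?_ b4⟩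
      · rwa [Set.union_assoc, ← Cmd.locked_par] at b2
      · exact hs₁.pred.of_agree C₂.mod_finite (fun x hx => (hm₂ x hx).2.2)
          (fun x hx => (hm₂ x hx).1) (fun x hx => (hm₂ x hx).2.1) hagree

/-- While `C` does not hold the lock `L` that it declares, the invariant of `L` is part of the local
heap of the declaration. -/
theorem Safe.lock (hT : T.StutterInvariant) {L : LockId Lk} (hL : J L = emp)
    (hprot : L = .ghost → ∃ p, Protects M e p R) {n : ℕ} {C : Cmd Var V Lk} {s : Stack Var V}
    {h h₁ h₂ : Heap Addr V} (hh : h.raw = h₁.raw + h₂.raw)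
    (hR : (if L ∈ C.locked then emp else R) s h₁)
    (hs : Safe M T e atomic (Function.update J L R) Q n C s h₂) :
    Safe M T e atomic J (star R Q) n (.lock L C) s h := by
  induction n generalizing C s h h₁ h₂ with
  | zero => trivial
  | succ n ih =>
    obtain ⟨h1, h2, h3⟩ := hs
    refine ⟨by simp, by simpa using h2, fun A f x g C' s' g' hA a2 a3 hf hx hg hst => ?_⟩
    simp only [Cmd.locked_lock] at a2 hx
    cases hst with
    | lockS =>
      refine ⟨?_, h, x, by simpa using hx, hg,
        Safe.skip ⟨h₁, h₂, isSum_iff.2 hh, by simpa using hR, h1 rfl⟩ n⟩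
      exact .of_shared_eq hT hx (by simp [hA]) (add_nonneg h.raw_nonneg hf)
        (add_nonneg h.raw_nonneg hf) (by rw [hg]; abel) (by rw [hg]; abel) (by simp) (by simp)
    | lock _ _ C₁ _ _ _ _ hst =>
      simp only [Cmd.locked_lock] at a3 ⊢
      -- A lock of the same name in the environment is a different lock.
      have hset : ∀ (X : Set (LockId Lk)) (L' : LockId Lk),
          J L' = emp ∨ (L' ∈ A \ {L} ∪ X ↔ L' ∈ A ∪ X) := by
        intro X L'
        by_cases hL' : L' = L
        · subst hL'; exact .inl hL
        · simp [hL']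
      obtain ⟨b1, k, x', b2, b3, b4⟩ := h3 (A \ {L}) f (h₁.raw + x) g C₁ s' g'
        (by simp [hA]) (a2.mono_left Set.sdiff_subset) (a3.mono_left Set.sdiff_subset) hf
        ((shared_update_iff hL).2 ⟨h₁, x, by simpa using hR,
          hx.of_emp fun L' => (hset _ L').imp_right Iff.symm, rfl⟩)
        (by rw [hg, hh]; abel) hst
      obtain ⟨k₁, y, c1, c2, rfl⟩ := (shared_update_iff hL).1 b2
      obtain ⟨k', hk'⟩ := Heap.exists_raw_add (g := g'.1) (h₁ := k₁) (h₂ := k) (z := y + f)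
        (add_nonneg c2.nonneg hf) (by rw [b3]; abel)
      refine ⟨⟨?_, ?_, by simp⟩, k', y, c2.of_emp (hset _), by rw [b3, hk']; abel,
        ih hk' (by simpa using c1) b4⟩
      · rintro ⟨p, hp⟩
        refine b1.1 ?_
        by_cases hLg : LockId.ghost = L
        · rw [hLg, hL] at hp
          exact (Protects.not_emp hp).elim
        · rw [Function.update_of_ne hLg]
          exact ⟨p, hp⟩
      · rintro D D' hD -
        obtain ⟨rfl, -⟩ := Cmd.lock.inj hD
        obtain ⟨p, hp⟩ := hprot rfl
        exact b1.1 ⟨p, by rwa [Function.update_self]⟩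

theorem Safe.within (hT : T.StutterInvariant) {l : Lk} (hL : J (.user l) = emp) {n : ℕ}
    {C : Cmd Var V Lk} {s : Stack Var V} {h : Heap Addr V}
    (hs : Safe M T e atomic J (star Q R) n C s h) :
    Safe M T e atomic (Function.update J (.user l) R) Q n (.within (.user l) C) s h := by
  have hmask : ∀ {A X : Set (LockId Lk)} {s : Stack Var V} {x : Addr → V → ℝ},
      Shared (Function.update J (.user l) R) (A ∪ insert (.user l) X) s x ↔
        Shared J (A ∪ X) s x := by
    intro A X s x
    have : ∀ L, mask (Function.update J (.user l) R) (A ∪ insert (.user l) X) L =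
        mask J (A ∪ X) L := by
      intro L
      by_cases h : L = .user l
      · subst h; simp [mask, hL]
      · simp [mask, h]
    exact ⟨fun h => h.of_mask_eq this, fun h => h.of_mask_eq fun L => (this L).symm⟩
  induction n generalizing C s h with
  | zero => trivial
  | succ n ih =>
    obtain ⟨h1, h2, h3⟩ := hs
    refine ⟨by simp, by simpa using h2, fun A f x g C' s' g' hA a2 a3 hf hx hg hst => ?_⟩
    have hx₀ := hx
    simp only [Cmd.locked_within, Set.disjoint_insert_right] at a2 hx
    rw [hmask] at hx
    cases hst with
    | withinS =>
      simp only [Cmd.locked_skip, Set.union_empty] at hx ⊢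
      obtain ⟨h₁, h₂, hsum, hQ, hR⟩ := h1 rfl
      rw [isSum_iff] at hsum
      refine ⟨?_, h₁, h₂.raw + x, ?_, by rw [hg, hsum]; abel, Safe.skip hQ n⟩
      · exact .of_shared_eq hT hx₀ (by simp [hA]) (add_nonneg h.raw_nonneg hf)
          (add_nonneg h.raw_nonneg hf) (by rw [hg]; abel) (by rw [hg]; abel) (by simp) (by simp)
      · exact (shared_update_iff hL).2 ⟨h₂, x, by simpa [a2.1] using hR, hx, rfl⟩
    | within _ _ C₁ _ _ _ _ hst =>
      simp only [Cmd.locked_within, Set.disjoint_insert_right] at a3 ⊢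
      obtain ⟨b1, k, x', b2, b3, b4⟩ := h3 A f x g C₁ s' g' hA a2.2 a3.2 hf hx hg hst
      exact ⟨b1.congr (by simp) (by simp) (by simp), k, x', hmask.2 b2, b3, ih b4⟩

theorem Safe.withLock (hT : T.StutterInvariant) {l : Lk} (hL : J (.user l) = emp)
    {E : Expr Var V} {C : Cmd Var V Lk} (hC : C.locked = ∅)
    (H : ∀ n s h, and (star P R) (expr M E) s h → Safe M T e atomic J (star Q R) n C s h)
    {s : Stack Var V} {h : Heap Addr V} (hP : P s h) (n : ℕ) :
    Safe M T e atomic (Function.update J (.user l) R) Q n (.withLock (.user l) E C) s h := by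
  cases n with
  | zero => trivial
  | succ n =>
    refine ⟨by simp, by simp [hC], fun A f x g C' s' g' hA _ a3 hf hx hg hst => ?_⟩
    simp only [Cmd.locked_withLock, hC, Set.union_empty] at hx
    cases hst with
    | withLock _ _ _ _ _ hE =>
      simp only [Cmd.locked_within, hC, insert_empty_eq, Set.disjoint_singleton_right] at a3 ⊢
      obtain ⟨hR, y, c1, c2, rfl⟩ := (shared_update_iff hL).1 hx
      obtain ⟨k, hk⟩ := Heap.exists_raw_add (g := g.1) (h₁ := h) (h₂ := hR) (z := y + f)
        (add_nonneg c2.nonneg hf) (by rw [hg]; abel)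
      refine ⟨?_, k, y, ?_, by rw [hg, hk]; abel, Safe.within hT hL (H n s k ⟨?_, hE⟩)⟩
      · exact .of_shared_eq hT hx hA (add_nonneg h.raw_nonneg hf)
          (add_nonneg h.raw_nonneg hf) (by rw [hg]; abel) (by rw [hg]; abel) (by simp) (by simp)
      · refine c2.of_mask_eq fun L => ?_
        by_cases h : L = .user l
        · subst h; simp [mask, hL]
        · simp [mask, h]
      · exact ⟨h, hR, isSum_iff.2 hk, hP, by simpa [a3] using c1⟩

theorem Safe.init (hT : T.StutterInvariant) (hL : J .ghost = emp) {p : Perm}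
    (hG : Protects M e p R) {C : Cmd Var V Lk} (hC : C.locked = ∅)
    (H : ∀ n s h, P s h → Safe M T e atomic (Function.update J .ghost R) Q n C s h)
    {s : Stack Var V} {h : Heap Addr V}
    (hP : star (fun s h => ∃ y : Fin T.k → V,
      absState M e p (fun i _ => y i) s h ∧ T.init y ∧ R s h) P s h) (n : ℕ) :
    Safe M T e atomic J (star R Q) n (.init C) s h := by
  cases n with
  | zero => trivial
  | succ n =>
    refine ⟨by simp, by simp [hC], fun A f x g C' s' g' hA _ a3 hf hx hg hst => ?_⟩
    cases hst
    simp only [Cmd.locked_init, Cmd.locked_lock, hC, Set.union_empty] at hx ⊢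
    obtain ⟨h₁, h₂, hsum, ⟨y, hy, hi, hR⟩, hP⟩ := hP
    rw [isSum_iff] at hsum
    refine ⟨⟨?_, by simp, ?_⟩, h, x, hx, hg,
      Safe.lock hT hL (fun _ => ⟨p, hG⟩) hsum (by simpa [hC] using hR) (H n s h₂ hP)⟩
    · rintro ⟨q, hq⟩
      rw [hL] at hq
      exact (Protects.not_emp hq).elim
    · intro _ _
      exact ⟨y, .of_le_raw (absState_iff.1 hy)
        (add_nonneg h₂.raw_nonneg (add_nonneg hx.nonneg hf)) (by rw [hg, hsum]; abel), hi⟩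

/-- A safe command without critical regions can be executed in one go. -/
theorem Safe.of_steps {C : Cmd Var V Lk} {s s' : Stack Var V} {g g' : NormHeap Addr V}
    (hst : Steps M e.stdOut atomic (.run C s g) (.run .skip s' g')) (hC : C.LockFree)
    {A : Set (LockId Lk)} (hA : .ghost ∉ A) {f : Addr → V → ℝ} (hf : 0 ≤ f) :
    ∃ n, ∀ h x, Safe M T e atomic J Q n C s h → Shared J A s x → g.1.raw = h.raw + x + f →
      ∃ h' x', Q s' h' ∧ Shared J A s' x' ∧ g'.1.raw = h'.raw + x' + f := by
  generalize hc : Conf.run C s g = c at hst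
  generalize hc' : Conf.run .skip s' g' = c' at hst
  induction hst using Steps.rec (motive_1 := fun _ _ _ => True) generalizing C s g with
  | refl c =>
    subst hc
    cases hc'
    exact ⟨1, fun h x hs hx hg => ⟨h, x, hs.1 rfl, hx, hg⟩⟩
  | head c c₁ c₂ h₁ h₂ _ ih =>
    subst hc hc'
    rcases c₁ with ⟨C₁, s₁, g₁⟩ | _
    · have hC₁ : C₁.LockFree := h₁.execInvariant.2.2.2.2 hC
      obtain ⟨n, hn⟩ := ih hC₁ rfl rfl
      refine ⟨n + 1, fun h x hs hx hg => ?_⟩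
      obtain ⟨-, -, hs⟩ := hs
      obtain ⟨-, h', x', b2, b3, b4⟩ := hs A f x g C₁ s₁ g₁ hA (by simp [hC.locked_eq_empty])
        (by simp [hC₁.locked_eq_empty]) hf (by simpa [hC.locked_eq_empty] using hx) hg h₁
      exact hn h' x' b4 (by simpa [hC₁.locked_eq_empty] using b2) b3
    · exact h₂.execInvariant.elim
  | _ => trivial

theorem Safe.next {p : Perm} {G : Assertion Addr Var V} (hL : J .ghost = emp)
    (hG : Protects M e p G) {C : Cmd Var V Lk} (hC : C.LockFree)
    {o : Fin T.k → Var} (ho : Function.Injective o)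
    (hfresh : ∀ i, o i ∉ fv P ∧ o i ∉ fv Q ∧ o i ∉ fv G ∧ (∀ L, o i ∉ fv (J L)) ∧ o i ∉ C.vars)
    (H : ∀ n s h, star (and (absState M e p (fun i s => s (o i))) G) P s h →
      Safe M T e atomic J (star (fun s h => ∃ y : Fin T.k → V,
        absState M e p (fun i _ => y i) s h ∧ T.next (fun i => s (o i)) y ∧ G s h) Q) n C s h)
    {s : Stack Var V} {h : Heap Addr V} (hP : P s h) (n : ℕ) :
    Safe M T e atomic (Function.update J .ghost G) Q n (.next C) s h := by
  cases n with
  | zero => trivial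
  | succ n =>
    refine ⟨by simp, by simp [hC.locked_eq_empty],
      fun A f x g C' s' g' hA _ a3 hf hx hg hst => ?_⟩
    simp only [Cmd.locked_next, hC.locked_eq_empty, Set.union_empty] at hx
    cases hst with
    | next _ _ _ _ _ _ hst =>
    simp only [Cmd.locked_skip, Set.union_empty]
    obtain ⟨hg₁, x₀, c1, c2, rfl⟩ := (shared_update_iff hL).1 hx
    simp only [hA, if_false] at c1
    obtain ⟨σ, hσ⟩ := hG.exists_le_raw c1
    -- Since the variables `o` are fresh, the run can be replayed from a stack where they hold
    -- the current abstract state `σ`.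
    have hfin : (Set.range o).Finite := Set.finite_range o
    let s₀ : Stack Var V := fun y => if hy : ∃ i, o i = y then σ hy.choose else s y
    have hs₀ : ∀ y, y ∉ Set.range o → s₀ y = s y := fun y hy => dif_neg hy
    have hs₀o : ∀ i, s₀ (o i) = σ i := by
      intro i
      have hi : ∃ j, o j = o i := ⟨i, rfl⟩
      have : hi.choose = i := ho hi.choose_spec
      change (if hy : ∃ j, o j = o i then σ hy.choose else s (o i)) = σ i
      rw [dif_pos hi, this]
    obtain ⟨s₁, hst₁, hs₁⟩ : ∃ s₁, Steps M e.stdOut atomic (.run C s₀ g) (.run .skip s₁ g') ∧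
        ∀ y, y ∉ Set.range o → s₁ y = s' y := by
      refine Stack.transfer hfin (p := fun t => ∃ t', Steps M e.stdOut atomic (.run C t g)
        (.run .skip t' g') ∧ ∀ y, y ∉ Set.range o → t' y = s' y) ?_ hs₀ ⟨s', hst, fun _ _ => rfl⟩
      rintro t y v ⟨i, rfl⟩ ⟨t', ht, hty⟩
      refine ⟨t'.set (o i) v, ht.set v (hfresh i).2.2.2.2, fun z hz => ?_⟩
      rw [Stack.set_of_ne _ _ fun h => hz ⟨i, h.symm⟩]
      exact hty z hz
    have hs₁o : ∀ i, s₁ (o i) = σ i := fun i =>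
      (hst₁.execInvariant.2.2.1 _ fun h => (hfresh i).2.2.2.2 (C.mod_subset_vars h)).trans (hs₀o i)
    have hfv : ∀ {α : Type _} {F : Stack Var V → α} {t t' : Stack Var V}, (∀ i, o i ∉ fv F) →
        (∀ y, y ∉ Set.range o → t y = t' y) → F t = F t' := fun hF ht =>
      apply_eq_of_agree hfin (by rintro _ ⟨i, rfl⟩; exact hF i) ht
    obtain ⟨m, hm⟩ := Safe.of_steps (T := T) (J := J) hst₁ hC hA hf
    obtain ⟨k, hk⟩ := Heap.exists_raw_add (g := g.1) (h₁ := hg₁) (h₂ := h) (z := x₀ + f)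
      (add_nonneg c2.nonneg hf) (by rw [hg]; abel)
    obtain ⟨k', x', hQ', hx', hg'⟩ := hm k x₀
      (H m s₀ k ⟨hg₁, h, isSum_iff.2 hk, ⟨absState_iff.2 fun i => by rw [hs₀o]; exact hσ i, by
        rwa [hfv (fun i => (hfresh i).2.2.1) hs₀]⟩, by rwa [hfv (fun i => (hfresh i).1) hs₀]⟩)
      (c2.of_stack_eq fun L => hfv (fun i => (hfresh i).2.2.2.1 L) hs₀) (by rw [hg, hk]; abel)
    obtain ⟨k₁, k₂, hsum, ⟨y, hy, hnext, hG'⟩, hQ'⟩ := hQ'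
    rw [isSum_iff] at hsum
    rw [hfv (fun i => (hfresh i).2.2.1) hs₁] at hG'
    rw [hfv (fun i => (hfresh i).2.1) hs₁] at hQ'
    simp only [hs₁o] at hnext
    refine ⟨⟨fun _ => ⟨σ, y, ?_, ?_, hnext⟩, by simp, by simp⟩, k₂, k₁.raw + x', ?_,
      by rw [hg', hsum]; abel, Safe.skip hQ' n⟩
    · exact .of_le_raw hσ (add_nonneg h.raw_nonneg (add_nonneg c2.nonneg hf))
        (by rw [hg]; abel)
    · exact .of_le_raw (absState_iff.1 hy) (add_nonneg k₂.raw_nonneg (add_nonneg hx'.nonneg hf))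
        (by rw [hg', hsum]; abel)
    · exact (shared_update_iff hL).2 ⟨k₁, x', by simpa [hA] using hG',
        hx'.of_stack_eq fun L => (hfv (fun i => (hfresh i).2.2.2.1 L) hs₁).symm, rfl⟩

end Rules

/-! ### Soundness of the logic -/

section Soundness

instance [Finite Lk] : Finite (LockId Lk) :=
  Finite.of_surjective (fun o : Option (Option Lk) => match o with
    | some (some l) => .user l
    | some none => .ghost
    | none => .marker) fun L => by
      rcases L with l | _ | _
      · exact ⟨some (some l), rfl⟩
      · exact ⟨some none, rfl⟩
      · exact ⟨none, rfl⟩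

variable {Addr Var V Lk : Type*}

open Classical in
theorem LockEnv.inv_extend (Γ : LockEnv Addr Var V Lk) (L : LockId Lk) (R : Assertion Addr Var V) :
    (Γ.extend L R).inv = Function.update Γ.inv L R := by
  funext L'
  by_cases h : L' = L
  · subst h; simp [LockEnv.inv, LockEnv.extend]
  · simp [LockEnv.inv, LockEnv.extend, h]

theorem LockEnv.inv_of_none {Γ : LockEnv Addr Var V Lk} {L : LockId Lk} (h : Γ L = none) :
    Γ.inv L = emp := by
  simp [LockEnv.inv, h]

/-- `emp` is the default invariant, so that declaring it has no effect on the resources. This is why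
the marker lock plays no role in `Safe`. -/
theorem LockEnv.inv_extend_emp {Γ : LockEnv Addr Var V Lk} {L : LockId Lk} (h : Γ L = none) :
    (Γ.extend L emp).inv = Γ.inv := by
  classical
  rw [LockEnv.inv_extend, ← LockEnv.inv_of_none h, Function.update_eq_self]

theorem LockEnv.notMem_fv_inv {Γ : LockEnv Addr Var V Lk} {x : Var} (h : x ∉ Γ.fv)
    (L : LockId Lk) : x ∉ CSLRef.fv (Γ.inv L) := fun hx => h (Set.mem_iUnion.2 ⟨L, hx⟩)

variable {M : ValueModel Addr V} {T : ATS V} {e : Encoding Addr T.k}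
  {atomic : Cmd Var V Lk → Prop} {Γ : LockEnv Addr Var V Lk} {P Q : Assertion Addr Var V}
  {C : Cmd Var V Lk}

theorem Derives.locked_eq_empty (hD : Derives M T e atomic Γ P C Q) : C.locked = ∅ := by
  induction hD <;> simp_all

theorem Derives.lock_ghost_notMem_subs (hD : Derives M T e atomic Γ P C Q) (C' : Cmd Var V Lk) :
    .lock .ghost C' ∉ C.subs := by
  induction hD <;> simp_all [Cmd.subs]

/-- The refinement logic is sound: derivable judgments describe safe commands. -/
theorem Derives.safe [Fintype (LockId Lk)] (hT : T.StutterInvariant)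
    (hatomic : ∀ C, atomic C → C.LockFree) (hD : Derives M T e atomic Γ P C Q) :
    ∀ n s h, P s h → Safe M T e atomic Γ.inv Q n C s h := by
  classical
  induction hD with
  | skip => exact fun n s h hP => Safe.skip hP n
  | assign Γ P x E hx => exact fun n s h hP => Safe.assign hT (LockEnv.notMem_fv_inv hx) hP n
  | write => exact fun n s h hP => Safe.write hT hP n
  | read Γ x E E' p hx =>
    simp only [Set.mem_union, not_or] at hx
    exact fun n s h hP => Safe.read hT hx.1.1 hx.1.2 (LockEnv.notMem_fv_inv hx.2) hP n
  | new Γ x E hx =>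
    simp only [Set.mem_union, not_or] at hx
    exact fun n s h hP => Safe.new hT hx.2 (LockEnv.notMem_fv_inv hx.1) hP n
  | free => exact fun n s h hP => Safe.free hT hP.1 n
  | seq Γ P R Q C₁ C₂ _ h₂ ih₁ ih₂ =>
    exact fun n s h hP => Safe.seq hT h₂.locked_eq_empty (fun m _ => ih₂ m) (ih₁ n s h hP)
  | cond Γ P Q E C₁ C₂ h₁ h₂ ih₁ ih₂ =>
    intro n s h hP
    rcases n with _ | n
    · trivial
    · exact Safe.ite hT h₁.locked_eq_empty h₂.locked_eq_empty (fun hE => ih₁ n s h ⟨hP, hE⟩)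
        fun hE => ih₂ n s h ⟨hP, hE⟩
  | loop Γ I E C h₁ ih => exact Safe.loop hT h₁.locked_eq_empty ih
  | par Γ P₁ P₂ Q₁ Q₂ C₁ C₂ h₁ hm₂ h₂ hm₁ ih₁ ih₂ =>
    have key : ∀ {F : Assertion Addr Var V} {B : Set Var} {F' : Assertion Addr Var V} {N : Set Var},
        (fv F ∪ B ∪ fv F' ∪ Γ.fv) ∩ N = ∅ →
          ∀ x ∈ N, x ∉ B ∧ x ∉ fv F' ∧ ∀ L, x ∉ fv (Γ.inv L) := by
      intro F B F' N hN x hx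
      have hx' : x ∉ fv F ∪ B ∪ fv F' ∪ Γ.fv := fun h => (Set.ext_iff.1 hN x).1 ⟨h, hx⟩
      simp only [Set.mem_union, not_or] at hx'
      exact ⟨hx'.1.1.2, hx'.1.2, LockEnv.notMem_fv_inv hx'.2⟩
    rintro n s h ⟨k₁, k₂, hsum, hP₁, hP₂⟩
    exact Safe.par hT (by simp [h₁.locked_eq_empty]) (key hm₁) (key hm₂) (isSum_iff.1 hsum)
      (ih₁ n s k₁ hP₁) (ih₂ n s k₂ hP₂)
  | lock Γ l R P Q C hl h₁ ih =>
    rw [LockEnv.inv_extend] at ih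
    rintro n s h ⟨k₁, k₂, hsum, hR, hP⟩
    exact Safe.lock hT (LockEnv.inv_of_none hl) (by simp) (isSum_iff.1 hsum)
      (by simpa [h₁.locked_eq_empty] using hR) (ih n s k₂ hP)
  | withLock Γ l R P Q E C hl h₁ ih =>
    rw [LockEnv.inv_extend]
    exact fun n s h hP =>
      Safe.withLock hT (LockEnv.inv_of_none hl) h₁.locked_eq_empty ih hP n
  | frame Γ P Q R C hR _ ih =>
    rintro n s h ⟨k₁, k₂, hsum, hP, hR'⟩
    exact Safe.frame (fun x hx hx' => (Set.ext_iff.1 hR x).1 ⟨hx', hx⟩) (isSum_iff.1 hsum) hR'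
      (ih n s k₁ hP)
  | cons Γ P P' Q Q' C hP hQ _ ih => exact fun n s h hP' => (ih n s h (hP s h hP')).cons hQ
  | ex Γ x P Q C hx _ ih =>
    simp only [Set.mem_union, not_or] at hx
    rintro n s h ⟨v, hv⟩
    exact Safe.ex (LockEnv.notMem_fv_inv hx.2) hx.1 (ih n _ h hv)
  | conj Γ P₁ P₂ Q₁ Q₂ C hJ _ _ ih₁ ih₂ =>
    exact fun n s h hP => Safe.conj hJ (ih₁ n s h hP.1) (ih₂ n s h hP.2)
  | disj Γ P₁ P₂ Q₁ Q₂ C _ _ ih₁ ih₂ =>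
    rintro n s h (hP | hP)
    · exact (ih₁ n s h hP).cons fun _ _ => .inl
    · exact (ih₂ n s h hP).cons fun _ _ => .inr
  | init Γ G p P Q C hg hm hG h₁ ih =>
    rw [LockEnv.inv_extend_emp (by simpa [LockEnv.extend] using hm), LockEnv.inv_extend] at ih
    exact fun n s h hP =>
      Safe.init hT (LockEnv.inv_of_none hg) hG h₁.locked_eq_empty ih hP n
  | next Γ G p P Q C o hg hG hC ho hfresh _ ih =>
    rw [LockEnv.inv_extend]
    intro n s h hP
    refine Safe.next (LockEnv.inv_of_none hg) hG (hatomic C hC) ho (fun i => ?_) ih hP n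
    have := hfresh i
    simp only [Set.mem_union, not_or] at this
    exact ⟨this.1.1.1.1, this.1.1.1.2, this.1.1.2, LockEnv.notMem_fv_inv this.1.2, this.2⟩
  | print Γ E E' _ => exact fun n s h hP => Safe.print hT hP n

end Soundness

/-! ### Traces -/

section Traces

variable {Addr Var V Lk : Type*} {T : ATS V} {e : Encoding Addr T.k}

theorem obs_of_not_isInit {stdOut : Addr} {C : Cmd Var V Lk} (hC : ¬ C.IsInit) (s : Stack Var V)
    (g : NormHeap Addr V) : (Conf.run C s g).obs stdOut = [] := by
  simp [Conf.obs, hC]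

theorem obs_lock_ghost {C : Cmd Var V Lk} (s : Stack Var V) {g : NormHeap Addr V}
    {σ : Fin T.k → V} (hσ : Stores e g σ) :
    (Conf.run (.lock .ghost C) s g).obs e.stdOut = [some (σ T.fst)] := by
  have : (Cmd.lock .ghost C).IsInit := ⟨C, by simp [Cmd.subs]⟩
  simp only [Conf.obs, this, if_true]
  exact congrArg (fun v => [v]) (hσ T.fst)

variable [Fintype (LockId Lk)] {M : ValueModel Addr V} {atomic : Cmd Var V Lk → Prop}
  {J : LockId Lk → Assertion Addr Var V} {Q : Assertion Addr Var V}

/-- The configuration `(C, s, g)` of a whole program is safe for `n` steps: a part of the heap is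
safe for `C`, and the rest provides the resources of all locks that `C` does not hold. -/
def SafeConf (M : ValueModel Addr V) (T : ATS V) (e : Encoding Addr T.k)
    (atomic : Cmd Var V Lk → Prop) (J : LockId Lk → Assertion Addr Var V)
    (Q : Assertion Addr Var V) (n : ℕ) (C : Cmd Var V Lk) (s : Stack Var V)
    (g : NormHeap Addr V) : Prop :=
  ∃ h x f, Safe M T e atomic J Q n C s h ∧ Shared J C.locked s x ∧ 0 ≤ f ∧
    g.1.raw = h.raw + x + f

theorem SafeConf.step {n : ℕ} {C C' : Cmd Var V Lk} {s s' : Stack Var V} {g g' : NormHeap Addr V}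
    (hc : SafeConf M T e atomic J Q (n + 1) C s g)
    (hst : Step M e.stdOut atomic (.run C s g) (.run C' s' g')) :
    Refines M T e J C g C' g' ∧ SafeConf M T e atomic J Q n C' s' g' := by
  obtain ⟨h, x, f, ⟨-, -, h3⟩, hx, hf, hg⟩ := hc
  obtain ⟨b1, h', x', b2, b3, b4⟩ := h3 ∅ f x g C' s' g' (by simp) (by simp) (by simp) hf
    (by simpa using hx) hg hst
  exact ⟨b1, h', x', f, b4, by simpa using b2, hf, b3⟩

/-- Once the ghost lock is declared, the program follows a path of the transition system until the
declaration is left. -/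
theorem SafeConf.exists_chain (l : List (Conf Addr Var V Lk)) :
    ∀ {C s g σ}, SafeConf M T e atomic J Q l.length (.lock .ghost C) s g → Stores e g σ →
      List.IsChain (Step M e.stdOut atomic) (.run (.lock .ghost C) s g :: l) →
      ∃ π, List.IsChain T.next (σ :: π) ∧
        l.flatMap (Conf.obs e.stdOut) = π.map fun τ => some (τ T.fst) := by
  induction l with
  | nil => exact fun _ _ _ => ⟨[], by simp, by simp⟩
  | cons c' l ih =>
    intro C s g σ hc hσ hl
    obtain ⟨hst, hl'⟩ := List.isChain_cons_cons.1 hl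
    rcases c' with ⟨C', s', g'⟩ | _
    · obtain ⟨hr, hc'⟩ := hc.step hst
      cases hst with
      | lockS =>
        refine ⟨[], by simp, ?_⟩
        rcases l with _ | ⟨c'', l⟩
        · simp [obs_of_not_isInit, Cmd.IsInit, Cmd.declared, Cmd.subs]
        · cases (List.isChain_cons_cons.1 hl').1
      | lock _ _ D _ _ _ _ _ =>
        obtain ⟨σ₀, σ', h₀, h', hnext⟩ := hr.simulates_of_lock _ _ rfl rfl
        obtain rfl := h₀.unique hσ
        obtain ⟨π, hπ, hobs⟩ := ih hc' h' hl'
        exact ⟨σ' :: π, List.isChain_cons_cons.2 ⟨hnext, hπ⟩, by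
          rw [List.flatMap_cons, hobs, obs_lock_ghost s' h']; rfl⟩
    · refine ⟨[], by simp, ?_⟩
      rcases l with _ | ⟨c'', l⟩
      · simp [Conf.obs]
      · cases (List.isChain_cons_cons.1 hl').1

theorem SafeConf.obs_init_mem_traces (l : List (Conf Addr Var V Lk)) {C : Cmd Var V Lk}
    {s : Stack Var V} {g : NormHeap Addr V}
    (hc : SafeConf M T e atomic J Q l.length (.init C) s g)
    (hl : List.IsChain (Step M e.stdOut atomic) (.run (.init C) s g :: l)) :
    l.flatMap (Conf.obs e.stdOut) ∈ List.map some '' T.traces := by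
  rcases l with _ | ⟨c', l⟩
  · exact ⟨[], .inl rfl, rfl⟩
  · obtain ⟨hst, hl'⟩ := List.isChain_cons_cons.1 hl
    cases hst with
    | init =>
    obtain ⟨hr, hc'⟩ := hc.step (.init C s g)
    obtain ⟨σ, hσ, hinit⟩ := hr.init _ rfl
    obtain ⟨π, hπ, hobs⟩ := hc'.exists_chain l hσ hl'
    refine ⟨_, .inr ⟨σ :: π, ⟨hinit, hπ⟩, rfl⟩, ?_⟩
    rw [List.flatMap_cons, hobs, obs_lock_ghost s hσ]
    simp

theorem SafeConf.obs_seq_mem_traces {C₂ : Cmd Var V Lk} (hC₂ : ¬ C₂.IsInit)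
    (l : List (Conf Addr Var V Lk)) :
    ∀ {C₁ s g}, C₁.NeverInit → SafeConf M T e atomic J Q l.length (.seq C₁ (.init C₂)) s g →
      List.IsChain (Step M e.stdOut atomic) (.run (.seq C₁ (.init C₂)) s g :: l) →
      (Conf.run (.seq C₁ (.init C₂)) s g :: l).flatMap (Conf.obs e.stdOut) ∈
        List.map some '' T.traces := by
  have hobs : ∀ {C₁ : Cmd Var V Lk} (s : Stack Var V) (g : NormHeap Addr V), C₁.NeverInit →
      (Conf.run (.seq C₁ (.init C₂)) s g).obs e.stdOut = [] := by
    intro C₁ s g h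
    refine obs_of_not_isInit ?_ s g
    rintro ⟨C', hC'⟩
    simp only [Cmd.subs, Set.mem_union, Set.mem_singleton_iff, reduceCtorEq, false_or] at hC'
    exact hC'.elim (h.2 C') fun h => hC₂ ⟨C', h⟩
  induction l with
  | nil =>
    intro C₁ s g h₁ _ _
    exact ⟨[], .inl rfl, by simp [hobs s g h₁]⟩
  | cons c' l ih =>
    intro C₁ s g h₁ hc hl
    obtain ⟨hst, hl'⟩ := List.isChain_cons_cons.1 hl
    rw [List.flatMap_cons, hobs s g h₁, List.nil_append]
    rcases c' with ⟨C', s', g'⟩ | _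
    · have hc' := (hc.step hst).2
      cases hst with
      | seqS =>
        have hinit : ¬ (Cmd.init C₂).IsInit := by
          rintro ⟨C', hC'⟩
          simp only [Cmd.subs, Set.mem_union, Set.mem_singleton_iff, reduceCtorEq, false_or] at hC'
          exact hC₂ ⟨C', hC'⟩
        rw [List.flatMap_cons, obs_of_not_isInit hinit, List.nil_append]
        exact hc'.obs_init_mem_traces l hl'
      | seq _ C₁' _ _ _ _ _ hst => exact ih (hst.execInvariant.2.2.2.1 h₁) hc' hl'
    · rcases l with _ | ⟨c'', l⟩
      · exact ⟨[], .inl rfl, by simp [Conf.obs]⟩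
      · cases (List.isChain_cons_cons.1 hl').1

end Traces

end CSLRef

theorem theorem3 {Addr Var V Lk : Type*} [Finite Lk] (M : ValueModel Addr V)
    (T : ATS V) (hT : T.StutterInvariant) (e : Encoding Addr T.k)
    (atomic : Cmd Var V Lk → Prop) (hatomic : ∀ C, atomic C → C.LockFree)
    (Γ : LockEnv Addr Var V Lk) (P Q : Assertion Addr Var V) (C : Cmd Var V Lk)
    (hC : C.ContinuouslyInitialized) (hD : Derives M T e atomic Γ P C Q) :
    CSLRef.traces M e.stdOut atomic (initialConfs C P Γ) ⊆ List.map some '' T.traces := by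
  have : Fintype (LockId Lk) := Fintype.ofFinite _
  rintro _ ⟨_, l, ⟨s, g, h, hS, hF, hhS, rfl, hsum, hsum', hP, hinv⟩, hl, rfl⟩
  obtain ⟨C₁, C₂, hC₁, rfl⟩ := hC
  have hsub := hD.lock_ghost_notMem_subs
  simp only [Cmd.subs, Set.mem_union, Set.mem_singleton_iff, reduceCtorEq, false_or,
    not_or] at hsub
  obtain ⟨x, y, hx, hy, hxy⟩ := Shared.of_bigStar hinv
  refine SafeConf.obs_seq_mem_traces (J := Γ.inv) (Q := Q) (fun ⟨C', h⟩ => (hsub C').2 h) l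
    ⟨hC₁, fun C' => (hsub C').1⟩ ⟨h, x, y + hF.raw, hD.safe hT hatomic _ s h hP, ?_,
      add_nonneg hy hF.raw_nonneg, ?_⟩ hl
  · rwa [← Set.compl_eq_univ_sdiff, compl_compl] at hx
  · rw [isSum_iff.1 hsum', isSum_iff.1 hsum, hxy]
    abel
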